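/- Let $a,b\in\mathbb R$, $\lambda>0$, $L>0$, and $T_{opt1}=\frac{(\lambda+1)L}{\lambda}$. Then there exist backstepping kernels $P^1,P^2$, that is, $C^1$ functions solving on the triangle $0\le x\le\xi\le L$ $$\lambda\,\partial_\xi P^1-\partial_xP^1+aP^2=0,\qquad \lambda\,\partial_xP^2+\lambda\,\partial_\xi P^2+bP^1=0,$$ $$P^1(x,x)=-\frac{a}{1+\lambda},\qquad P^1(0,\xi)=P^2(0,\xi),$$ such that, with the injection gains $\Gamma_1(x)=\lambda P^1(x,L)$ and $\Gamma_2(x)=\lambda P^2(x,L)$, $x\in[0,L]$, the following holds. Let $U\in L^2_{loc}([0,\infty))$ be any input, let $(y_1,y_2)$ be any solution of the reflected system $$\begin{cases}\partial_t y_1-\partial_x y_1+ay_2=0, & (t,x)\in(0,\infty)\times(0,L),\\ \partial_t y_2+\lambda\partial_x y_2+by_1=0, & (t,x)\in(0,\infty)\times(0,L),\\ y_2(t,0)=y_1(t,0),\quad y_1(t,L)=U(t), & t>0,\end{cases}$$ with output $Y(t)=y_2(t,L)$, and let $(\hat y_1,\hat y_2)$ be any solution of the observer $$\begin{cases}\partial_t\hat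 y_1-\partial_x\hat y_1+a\hat y_2=\Gamma_1(x)\big(Y(t)-\hat y_2(t,L)\big), & (t,x)\in(0,\infty)\times(0,L),\\ \partial_t\hat y_2+\lambda\partial_x\hat y_2+b\hat y_1=\Gamma_2(x)\big(Y(t)-\hat y_2(t,L)\big), & (t,x)\in(0,\infty)\times(0,L),\\ \hat y_2(t,0)=\hat y_1(t,0),\quad \hat y_1(t,L)=U(t), & t>0,\end{cases}$$ both with arbitrary, possibly different, initial data in $L^2(0,L)^2$. Then $y_1(t,\cdot)=\hat y_1(t,\cdot)$ and $y_2(t,\cdot)=\hat y_2(t,\cdot)$ in $L^2(0,L)$ for every $t\ge T_{opt1}$, and the boundary values $y_i(t,0)=\hat y_i(t,0)$ ($i=1,2$) and $y_2(t,L)=\hat y_2(t,L)$ agree for almost every $t\ge T_{opt1}$. Here solutions are weak solutions in $C^0([0,\infty);L^2(0,L)^2)$ whose boundary values at $x=0$ and $x=L$ are functions in $L^2_{loc}([0,\infty))$: the equations and boundary conditions hold in the sense of integration by parts over $(0,\tau)\times(0,L)$, for every $\tau\ge0$, against every $C^1$ test function, with no condition on the test function at $x=0$ or $x=L$. -/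

import Mathlib

open MeasureTheory Set

/-- The space `L²(0, L)` of real square-integrable functions. -/
abbrev StateSpace (L : ℝ) : Type :=
  Lp ℝ 2 ((volume : Measure ℝ).restrict (Ioo 0 L))

/-- `g ∈ L²_loc([0, ∞))`. -/
def IsL2Loc (g : ℝ → ℝ) : Prop :=
  ∀ T : ℝ, 0 < T → MemLp g 2 ((volume : Measure ℝ).restrict (Ioo 0 T))

/-- `y ∈ C⁰([0, ∞); L²(0, L))` is a weak solution of the transport equation
`∂ₜ y + c ∂ₓ y = F` on `(0, ∞) × (0, L)`, with boundary values `y(t, 0) = yLeft t` and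
`y(t, L) = yRight t` in `L²_loc`.

The identity is the one obtained by multiplying the equation by an arbitrary `C¹` test function
and integrating by parts over `(0, τ) × (0, L)`. The test functions are not required to vanish at
`x = 0` or `x = L`, so that the identity determines both boundary values almost everywhere (for
`c ≠ 0`). The initial value is `y 0`. -/
structure IsTransportSolution (L c : ℝ) (F : ℝ → ℝ → ℝ) (y : ℝ → StateSpace L)
    (yLeft yRight : ℝ → ℝ) : Prop where
  continuousOn : ContinuousOn y (Ici 0)
  left_l2Loc : IsL2Loc yLeft
  right_l2Loc : IsL2Loc yRight
  weak : ∀ φ : ℝ → ℝ → ℝ, ContDiff ℝ 1 (Function.uncurry φ) → ∀ τ : ℝ, 0 ≤ τ →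
    (∫ x in Ioo 0 L, y τ x * φ τ x) - (∫ x in Ioo 0 L, y 0 x * φ 0 x) =
      (∫ t in (0 : ℝ)..τ, ∫ x in Ioo 0 L,
        y t x * (deriv (fun s => φ s x) t + c * deriv (fun z => φ t z) x))
      + (∫ t in (0 : ℝ)..τ, ∫ x in Ioo 0 L, F t x * φ t x)
      - c * ∫ t in (0 : ℝ)..τ, (yRight t * φ t L - yLeft t * φ t 0)

/-- `(y₁, y₂)` is a weak solution in `C⁰([0, ∞); L²(0, L)²)` of the reflected system
`∂ₜ y₁ - ∂ₓ y₁ + a y₂ = 0`, `∂ₜ y₂ + lam ∂ₓ y₂ + b y₁ = 0`,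
`y₂(t, 0) = y₁(t, 0)`, `y₁(t, L) = U(t)`.
Here `w` is the common boundary value `y₁(t, 0) = y₂(t, 0)`, and `Y` is the output `y₂(t, L)`. -/
structure IsPlantSolution (lam a b L : ℝ) (U : ℝ → ℝ) (y₁ y₂ : ℝ → StateSpace L)
    (w Y : ℝ → ℝ) : Prop where
  fst : IsTransportSolution L (-1) (fun t x => -a * y₂ t x) y₁ w U
  snd : IsTransportSolution L lam (fun t x => -b * y₁ t x) y₂ w Y

/-- `(z₁, z₂)` is a weak solution in `C⁰([0, ∞); L²(0, L)²)` of the observer with injection gains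
`Γ₁, Γ₂` and measured output `Y`,
`∂ₜ z₁ - ∂ₓ z₁ + a z₂ = Γ₁(x) (Y(t) - z₂(t, L))`,
`∂ₜ z₂ + lam ∂ₓ z₂ + b z₁ = Γ₂(x) (Y(t) - z₂(t, L))`,
`z₂(t, 0) = z₁(t, 0)`, `z₁(t, L) = U(t)`.
Here `v` is the common boundary value `z₁(t, 0) = z₂(t, 0)`, and `Z` is `z₂(t, L)`. -/
structure IsObserverSolution (lam a b L : ℝ) (Γ₁ Γ₂ : ℝ → ℝ) (U Y : ℝ → ℝ)
    (z₁ z₂ : ℝ → StateSpace L) (v Z : ℝ → ℝ) : Prop where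
  fst : IsTransportSolution L (-1) (fun t x => -a * z₂ t x + Γ₁ x * (Y t - Z t)) z₁ v U
  snd : IsTransportSolution L lam (fun t x => -b * z₁ t x + Γ₂ x * (Y t - Z t)) z₂ v Z

/-- `(P₁, P₂)` are backstepping kernels for the estimation error `(e₁, e₂)`: `C¹` functions that
solve, on the triangle `0 ≤ x ≤ ξ ≤ L`, the kernel equations
`lam ∂_ξ P₁ - ∂ₓ P₁ + a P₂ = 0`, `lam ∂ₓ P₂ + lam ∂_ξ P₂ + b P₁ = 0`
with `P₁(x, x) = -a / (1 + lam)` and `P₁(0, ξ) = P₂(0, ξ)`.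

These are the conditions under which, with gains `lam Pᵢ(x, L)`, the transformation
`e₁ = α + ∫ₓᴸ P₁(x, ξ) β(ξ) dξ`, `e₂ = β + ∫ₓᴸ P₂(x, ξ) β(ξ) dξ` relates the error system to one
whose equations contain `α` but not `β` as a source, with `α(t, 0) = β(t, 0)`, `α(t, L) = 0`:
the terms in `β(t, x)` and `β(t, ξ)` cancel in the equations and at `x = 0`. -/
structure IsBacksteppingKernel (lam a b L : ℝ) (P₁ P₂ : ℝ → ℝ → ℝ) : Prop where
  contDiff_fst : ContDiff ℝ 1 (Function.uncurry P₁)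
  contDiff_snd : ContDiff ℝ 1 (Function.uncurry P₂)
  eq_fst : ∀ x ξ : ℝ, 0 ≤ x → x ≤ ξ → ξ ≤ L →
    lam * deriv (fun s => P₁ x s) ξ - deriv (fun s => P₁ s ξ) x + a * P₂ x ξ = 0
  eq_snd : ∀ x ξ : ℝ, 0 ≤ x → x ≤ ξ → ξ ≤ L →
    lam * deriv (fun s => P₂ s ξ) x + lam * deriv (fun s => P₂ x s) ξ + b * P₁ x ξ = 0
  diag : ∀ x : ℝ, 0 ≤ x → x ≤ L → P₁ x x = -a / (1 + lam)
  left : ∀ ξ : ℝ, 0 ≤ ξ → ξ ≤ L → P₁ 0 ξ = P₂ 0 ξ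

/-! The error `e = y - z` is driven only by its own output error `e₂(t, L)`, and `e₁(t, L) = 0`.
Since `e` is merely a weak solution, the proof does not transform `e` but argues by duality. Pair
`e` with a solution `φ` of the adjoint system with sources `χ(t) σᵢ(x)`, where `χ` is supported in
`(T, T₁)`. The condition `φ₁(t, 0) = lam φ₂(t, 0)` removes the unknown boundary value at `0`, and
the nonlocal condition `φ₂(t, L) + ∫ (P₁(ξ, L) φ₁ + P₂(ξ, L) φ₂) dξ = 0` removes the output error
together with the injection. If moreover `φ` vanishes at time `0` and at some late time, all that
remains is `∫ χ (⟨e₁, σ₁⟩ + ⟨e₂, σ₂⟩) dt = 0`. As `χ` and `σᵢ` are arbitrary, continuity in time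
gives `e = 0` from `T` on (`pairing_error_eq_zero`).

Such a `φ` is built by treating `x` as the evolution variable, with data `(lam g, g)` at `x = 0`
(`exists_adjoint_cauchy`). By the kernel equations, the Volterra transform of `φ` changes along a
characteristic of speed `lam` only through the sources (`IsBacksteppingKernel.transform_eq`). The
nonlocal condition at `L` therefore determines `g` explicitly as an integral of the sources. If `χ`
lives in `(T₀, T₁)`, then `g` vanishes up to `T₀ - L / lam`, and finite speed of propagation makes
`φ` vanish where `t + x ≤ T₀ - L / lam`. This region contains `{0} × [0, L]` exactly when `T₀ ≥ L +
L / lam`, which is the time in the theorem.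

The kernels are written down as contour integrals of exponentials (`exists_isBacksteppingKernel`).
Once the states agree, testing with products `χ(t) ψ(x)` isolates the boundary values
(`IsTransportSolution.boundary_identity`). -/

/-! ### Partial derivatives and integrals depending on a parameter -/

/-- `f` has the continuous partial derivatives `f₁`, `f₂`. -/
structure HasPartials (f f₁ f₂ : ℝ → ℝ → ℝ) : Prop where
  fst : ∀ t x, HasDerivAt (fun s => f s x) (f₁ t x) t
  snd : ∀ t x, HasDerivAt (f t) (f₂ t x) x
  cont_fst : Continuous (Function.uncurry f₁)
  cont_snd : Continuous (Function.uncurry f₂)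

/-- `f` is continuous with continuous derivative `f'` in the first variable. -/
structure HasFstPartial (f f' : ℝ → ℝ → ℝ) : Prop where
  cont : Continuous (Function.uncurry f)
  cont_deriv : Continuous (Function.uncurry f')
  deriv : ∀ t x, HasDerivAt (fun s => f s x) (f' t x) t

namespace HasPartials

variable {f f₁ f₂ : ℝ → ℝ → ℝ}

theorem hasStrictFDerivAt (h : HasPartials f f₁ f₂) (p : ℝ × ℝ) :
    HasStrictFDerivAt (Function.uncurry f)
      ((ContinuousLinearMap.toSpanSingleton ℝ (f₁ p.1 p.2)).coprod
        (ContinuousLinearMap.toSpanSingleton ℝ (f₂ p.1 p.2))) p := by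
  have hc : Continuous fun c : ℝ => ContinuousLinearMap.toSpanSingleton ℝ c :=
    (ContinuousLinearMap.toSpanSingletonCLE (𝕜 := ℝ) (E := ℝ)).continuous
  exact hasStrictFDerivAt_uncurry_coprod (u := p) (f := f)
    (f₁ := fun t x => ContinuousLinearMap.toSpanSingleton ℝ (f₁ t x))
    (f₂ := fun t x => ContinuousLinearMap.toSpanSingleton ℝ (f₂ t x))
    (Filter.Eventually.of_forall fun v => (h.fst v.1 v.2).hasFDerivAt)
    (Filter.Eventually.of_forall fun v => (h.snd v.1 v.2).hasFDerivAt)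
    (hc.comp h.cont_fst).continuousAt (hc.comp h.cont_snd).continuousAt

theorem contDiff (h : HasPartials f f₁ f₂) : ContDiff ℝ 1 (Function.uncurry f) := by
  have hc : Continuous fun c : ℝ => ContinuousLinearMap.toSpanSingleton ℝ c :=
    (ContinuousLinearMap.toSpanSingletonCLE (𝕜 := ℝ) (E := ℝ)).continuous
  rw [contDiff_one_iff_hasFDerivAt]
  refine ⟨_, ?_, fun p => (h.hasStrictFDerivAt p).hasFDerivAt⟩
  have h1 := hc.comp h.cont_fst
  have h2 := hc.comp h.cont_snd
  exact (ContinuousLinearMap.coprodEquivL ℝ).continuous.comp (h1.prodMk h2)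

theorem cont (h : HasPartials f f₁ f₂) : Continuous (Function.uncurry f) :=
  h.contDiff.continuous

theorem hasFstPartial (h : HasPartials f f₁ f₂) : HasFstPartial f f₁ :=
  ⟨h.cont, h.cont_fst, h.fst⟩

theorem comp_curve (h : HasPartials f f₁ f₂) {α β : ℝ → ℝ} {α' β' s : ℝ}
    (hα : HasDerivAt α α' s) (hβ : HasDerivAt β β' s) :
    HasDerivAt (fun r => f (α r) (β r)) (f₁ (α s) (β s) * α' + f₂ (α s) (β s) * β') s := by
  have h1 := (h.hasStrictFDerivAt (α s, β s)).hasFDerivAt.comp_hasDerivAt s (hα.prodMk hβ)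
  convert! h1 using 1
  simp [mul_comm]

end HasPartials

theorem hasDerivAt_integral_of_continuous {E : Type*} [NormedAddCommGroup E] [NormedSpace ℝ E]
    {K K' : ℝ → ℝ → E} (hK : Continuous (Function.uncurry K))
    (hK' : Continuous (Function.uncurry K'))
    (h : ∀ t x, HasDerivAt (fun s => K s x) (K' t x) t) (a b t : ℝ) :
    HasDerivAt (fun s => ∫ x in a..b, K s x) (∫ x in a..b, K' t x) t := by
  obtain ⟨C, hC⟩ := ((isCompact_closedBall t 1).prod (isCompact_uIcc (a := a) (b := b))).exists_bound_of_continuousOn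
    hK'.continuousOn
  refine (intervalIntegral.hasDerivAt_integral_of_dominated_loc_of_deriv_le (bound := fun _ => C)
    (Metric.closedBall_mem_nhds t one_pos) ?_ ?_ ?_ ?_ ?_ ?_).2
  · exact Filter.Eventually.of_forall fun s =>
      (hK.comp (Continuous.prodMk_right s)).aestronglyMeasurable
  · exact (hK.comp (Continuous.prodMk_right t)).intervalIntegrable _ _
  · exact (hK'.comp (Continuous.prodMk_right t)).aestronglyMeasurable
  · exact Filter.Eventually.of_forall fun x hx s hs => hC (s, x) ⟨hs, uIoc_subset_uIcc hx⟩
  · exact intervalIntegrable_const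
  · exact Filter.Eventually.of_forall fun x _ s _ => h s x

theorem continuous_primitive_param {f : ℝ → ℝ → ℝ} (hf : Continuous (Function.uncurry f)) :
    Continuous (Function.uncurry fun t x => ∫ ξ in (0 : ℝ)..x, f t ξ) :=
  intervalIntegral.continuous_parametric_intervalIntegral_of_continuous
    (f := fun p : ℝ × ℝ => f p.1) (by fun_prop) continuous_snd

theorem HasFstPartial.primitive {f f' : ℝ → ℝ → ℝ} (h : HasFstPartial f f') :
    HasPartials (fun t x => ∫ ξ in (0 : ℝ)..x, f t ξ) (fun t x => ∫ ξ in (0 : ℝ)..x, f' t ξ) f where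
  fst t x := hasDerivAt_integral_of_continuous h.cont h.cont_deriv h.deriv 0 x t
  snd t x := by
    have hc : Continuous (f t) := h.cont.comp (Continuous.prodMk_right t)
    exact intervalIntegral.integral_hasDerivAt_right (hc.intervalIntegrable _ _)
      (hc.stronglyMeasurableAtFilter _ _) hc.continuousAt
  cont_fst := continuous_primitive_param h.cont_deriv
  cont_snd := h.cont

/-- Leibniz rule with the parameter also as upper limit. -/
theorem HasFstPartial.hasDerivAt_diag_primitive {f f' : ℝ → ℝ → ℝ} (h : HasFstPartial f f')
    (x : ℝ) :
    HasDerivAt (fun s => ∫ ξ in (0 : ℝ)..s, f s ξ) (f x x + ∫ ξ in (0 : ℝ)..x, f' x ξ) x := by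
  have := h.primitive.comp_curve (hasDerivAt_id x) (hasDerivAt_id x)
  simp only [id, mul_one] at this
  rwa [add_comm]

/-! ### Integration along characteristics -/

/-- Integration of a source along the lines `t + c x = const`, from `x = 0`. -/
noncomputable def charInt (c : ℝ) (f : ℝ → ℝ → ℝ) (t x : ℝ) : ℝ :=
  ∫ ξ in (0 : ℝ)..x, f (t + c * (x - ξ)) ξ

theorem continuous_charInt (c : ℝ) {f : ℝ → ℝ → ℝ} (hf : Continuous (Function.uncurry f)) :
    Continuous (Function.uncurry (charInt c f)) := by
  unfold charInt
  exact intervalIntegral.continuous_parametric_intervalIntegral_of_continuous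
    (f := fun (p : ℝ × ℝ) ξ => f (p.1 + c * (p.2 - ξ)) ξ) (by fun_prop) continuous_snd

/-- Moving the endpoint in `x` also shifts the argument `t`, so smoothness in `t` is converted into
smoothness in `x`. Hence sources `χ(t) σ(x)` with `σ` only continuous still give `C¹` solutions. -/
theorem HasFstPartial.charInt {f f' : ℝ → ℝ → ℝ} (h : HasFstPartial f f') (c : ℝ) :
    HasPartials (charInt c f) (charInt c f') (fun t x => f t x + c * charInt c f' t x) := by
  -- In the sheared coordinate `r = t + c x`, which is constant on the line, the integral is an
  -- ordinary primitive in `x`.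
  have hshift : HasFstPartial (fun r ξ => f (r - c * ξ) ξ) (fun r ξ => f' (r - c * ξ) ξ) := by
    refine ⟨?_, ?_, fun t x => ?_⟩
    · have := h.cont; fun_prop
    · have := h.cont_deriv; fun_prop
    · exact (h.deriv (t - c * x) x).comp_sub_const t (c * x)
  have e : ∀ g : ℝ → ℝ → ℝ, ∀ t x, (∫ ξ in (0 : ℝ)..x, g (t + c * x - c * ξ) ξ) = _root_.charInt c g t x := by
    intro g t x
    unfold _root_.charInt
    congr 1; ext ξ; congr 1; ring
  have hp := hshift.primitive
  refine ⟨fun t x => ?_, fun t x => ?_, continuous_charInt c h.cont_deriv, ?_⟩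
  · have := hp.comp_curve ((hasDerivAt_id t).add_const (c * x)) (hasDerivAt_const t x)
    simp only [id, mul_one, mul_zero, add_zero, e] at this
    exact this
  · have := hp.comp_curve (((hasDerivAt_id x).const_mul c).const_add t) (hasDerivAt_id x)
    simp only [id, mul_one, e, add_sub_cancel_right] at this
    convert this using 1; ring
  · have h1 := continuous_charInt c h.cont_deriv
    have h2 := h.cont
    fun_prop

theorem charInt_eq_zero {c : ℝ} {f : ℝ → ℝ → ℝ} {t x : ℝ} (hx : 0 ≤ x)
    (h : ∀ ξ ∈ Icc 0 x, f (t + c * (x - ξ)) ξ = 0) : charInt c f t x = 0 := by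
  unfold charInt
  rw [intervalIntegral.integral_congr (g := fun _ => 0)]
  · simp
  · intro ξ hξ
    rw [uIcc_of_le hx] at hξ
    exact h ξ hξ

/-- Each integration gains one factor of the exponential series. The shift in `t` costs nothing
because the bounds are uniform in `t` on strips. -/
theorem abs_charInt_le (c : ℝ) {f : ℝ → ℝ → ℝ} {M R : ℝ} {n : ℕ}
    (h : ∀ t x, |x| ≤ R → |f t x| ≤ M * |x| ^ n / n.factorial) (t x : ℝ) (hx : |x| ≤ R) :
    |charInt c f t x| ≤ M * |x| ^ (n + 1) / (n + 1).factorial := by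
  have hi : IntervalIntegrable (fun ξ => M / n.factorial * |ξ - 0| ^ n) volume 0 x :=
    (by fun_prop : Continuous fun ξ : ℝ => M / n.factorial * |ξ - 0| ^ n).intervalIntegrable _ _
  calc |charInt c f t x| ≤ |∫ ξ in (0 : ℝ)..x, M / n.factorial * |ξ - 0| ^ n| := by
        rw [charInt, ← Real.norm_eq_abs]
        refine intervalIntegral.norm_integral_le_abs_of_norm_le ?_ hi
        refine (ae_restrict_iff' measurableSet_uIoc).2 (Filter.Eventually.of_forall fun ξ hξ => ?_)
        have hξ' : |ξ| ≤ |x| := by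
          simpa using abs_sub_left_of_mem_uIcc (uIoc_subset_uIcc hξ)
        rw [Real.norm_eq_abs, sub_zero, div_mul_eq_mul_div]
        exact h _ ξ (hξ'.trans hx)
    _ = |M / n.factorial * ∫ ξ in uIoc (0 : ℝ) x, |ξ - 0| ^ n| := by
        rw [intervalIntegral.integral_const_mul, abs_mul, abs_mul,
          intervalIntegral.abs_intervalIntegral_eq]
    _ ≤ M * |x| ^ (n + 1) / (n + 1).factorial := by
        have hM : 0 ≤ M * |x| ^ n / n.factorial := (abs_nonneg _).trans (h 0 x hx)
        rw [integral_pow_abs_sub_uIoc, sub_zero]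
        have e : M / n.factorial * (|x| ^ (n + 1) / (n + 1)) =
            M * |x| ^ (n + 1) / (n + 1).factorial := by
          rw [Nat.factorial_succ]; push_cast; field_simp
        have e' : M / n.factorial * (|x| ^ (n + 1) / (n + 1)) =
            M * |x| ^ n / n.factorial * (|x| / (n + 1)) := by
          field_simp
          ring
        rw [abs_of_nonneg (by rw [e']; positivity), e]

/-- A series of functions with locally summable bounds can be integrated termwise. -/
theorem charInt_tsum (c : ℝ) {f : ℕ → ℝ → ℝ → ℝ} (hf : ∀ n, Continuous (Function.uncurry (f n)))
    {u : ℕ → ℝ} (hu : Summable u) {R : ℝ} (hb : ∀ n t x, |x| ≤ R → |f n t x| ≤ u n)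
    (t x : ℝ) (hx : |x| ≤ R) :
    HasSum (fun n => charInt c (f n) t x) (charInt c (fun t x => ∑' n, f n t x) t x) := by
  have hle : ∀ ξ ∈ uIoc 0 x, |ξ| ≤ R := fun ξ hξ =>
    (by simpa using abs_sub_left_of_mem_uIcc (uIoc_subset_uIcc hξ) : |ξ| ≤ |x|).trans hx
  refine intervalIntegral.hasSum_integral_of_dominated_convergence (fun n _ => u n) ?_ ?_ ?_ ?_ ?_
  · intro n
    have := hf n
    exact (by fun_prop : Continuous fun ξ => f n (t + c * (x - ξ)) ξ).aestronglyMeasurable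
  · exact fun n => Filter.Eventually.of_forall fun ξ hξ => hb n _ ξ (hle ξ hξ)
  · exact Filter.Eventually.of_forall fun _ _ => hu
  · exact intervalIntegrable_const
  · refine Filter.Eventually.of_forall fun ξ hξ => Summable.hasSum ?_
    exact Summable.of_norm_bounded hu fun n => hb n _ ξ (hle ξ hξ)

/-! ### Volterra equations by Picard iteration -/

/-- Picard iterates of `f = d + κ charInt c₁ (charInt c₂ f)`. -/
noncomputable def picardTerm (c₁ c₂ κ : ℝ) (d : ℝ → ℝ → ℝ) : ℕ → ℝ → ℝ → ℝ
  | 0 => d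
  | n + 1 => fun t x => κ * charInt c₁ (charInt c₂ (picardTerm c₁ c₂ κ d n)) t x

section Volterra

variable {c₁ c₂ κ : ℝ} {d d' : ℝ → ℝ → ℝ}

theorem HasFstPartial.const_mul {f f' : ℝ → ℝ → ℝ} (h : HasFstPartial f f') (k : ℝ) :
    HasFstPartial (fun t x => k * f t x) (fun t x => k * f' t x) := by
  have h1 := h.cont
  have h2 := h.cont_deriv
  exact ⟨by fun_prop, by fun_prop, fun t x => (h.deriv t x).const_mul k⟩

theorem HasFstPartial.add {f f' g g' : ℝ → ℝ → ℝ} (h : HasFstPartial f f')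
    (hg : HasFstPartial g g') :
    HasFstPartial (fun t x => f t x + g t x) (fun t x => f' t x + g' t x) := by
  have h1 := h.cont
  have h2 := h.cont_deriv
  have h3 := hg.cont
  have h4 := hg.cont_deriv
  exact ⟨by fun_prop, by fun_prop, fun t x => (h.deriv t x).add (hg.deriv t x)⟩

/-- The iteration commutes with translations in `t`, so differentiating an iterate in `t` amounts to
iterating the differentiated datum. The same bounds then serve both series. -/
theorem HasFstPartial.picardTerm (h : HasFstPartial d d') (n : ℕ) :
    HasFstPartial (picardTerm c₁ c₂ κ d n) (picardTerm c₁ c₂ κ d' n) := by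
  induction n with
  | zero => exact h
  | succ n ih =>
    exact (((ih.charInt c₂).hasFstPartial.charInt c₁).hasFstPartial).const_mul κ

theorem abs_picardTerm_le {M R : ℝ} (hd : ∀ t x, |x| ≤ R → |d t x| ≤ M) (n : ℕ) (t x : ℝ)
    (hx : |x| ≤ R) :
    |picardTerm c₁ c₂ κ d n t x| ≤ M * |κ| ^ n * |x| ^ (2 * n) / (2 * n).factorial := by
  induction n generalizing t x with
  | zero => simpa [picardTerm] using hd t x hx
  | succ n ih =>
    have h1 := abs_charInt_le c₁ (abs_charInt_le c₂ ih) t x hx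
    rw [picardTerm, abs_mul]
    calc _ ≤ |κ| * _ := mul_le_mul_of_nonneg_left h1 (abs_nonneg _)
      _ = _ := by rw [show 2 * (n + 1) = 2 * n + 1 + 1 by ring]; ring

theorem summable_picard_bound (M K R : ℝ) :
    Summable fun n : ℕ => M * K ^ n * R ^ (2 * n) / (2 * n).factorial := by
  have h := (Real.summable_pow_div_factorial (max 1 |K| * |R|)).comp_injective
    (i := fun n : ℕ => 2 * n) (fun a b h => by simpa using h)
  refine Summable.of_norm_bounded (h.mul_left |M|) fun n => ?_
  -- Replacing `|K|` by `max 1 |K|` allows the exponent to be doubled, so that the terms are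
  -- dominated by the even terms of an exponential series.
  have hK : |K| ^ n ≤ max 1 |K| ^ (2 * n) := by
    calc |K| ^ n ≤ max 1 |K| ^ n := by gcongr; exact le_max_right _ _
      _ ≤ _ := pow_le_pow_right₀ (le_max_left _ _) (by omega)
  simp only [Function.comp, Real.norm_eq_abs, abs_div, abs_mul, abs_pow, Nat.abs_cast, mul_pow]
  rw [mul_assoc, mul_div_assoc]
  gcongr

/-- Existence for the Volterra equation `f = d + κ charInt c₁ (charInt c₂ f)`, with
differentiability in the first variable and finite speed of propagation. -/
theorem exists_volterra_solution (c₁ c₂ κ : ℝ) (h : HasFstPartial d d')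
    (hd : ∀ R, ∃ M, ∀ t x, |x| ≤ R → |d t x| ≤ M)
    (hd' : ∀ R, ∃ M, ∀ t x, |x| ≤ R → |d' t x| ≤ M) :
    ∃ f f' : ℝ → ℝ → ℝ, HasFstPartial f f' ∧
      (∀ t x, f t x = d t x + κ * charInt c₁ (charInt c₂ f) t x) ∧
      ∀ A : ℝ → ℝ → Prop, (∀ t x, A t x → 0 ≤ x ∧ d t x = 0 ∧
        ∀ ξ ∈ Icc 0 x, A (t + c₁ * (x - ξ)) ξ ∧ A (t + c₂ * (x - ξ)) ξ) →
        ∀ t x, A t x → f t x = 0 := by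
  set p := picardTerm c₁ c₂ κ d with hp
  set p' := picardTerm c₁ c₂ κ d' with hp'
  have hpart : ∀ n, HasFstPartial (p n) (p' n) := fun n => h.picardTerm n
  have bound : ∀ e : ℝ → ℝ → ℝ, (∀ R, ∃ M, ∀ t x, |x| ≤ R → |e t x| ≤ M) → ∀ R, ∃ u : ℕ → ℝ,
      Summable u ∧ ∀ n t x, |x| ≤ R → |picardTerm c₁ c₂ κ e n t x| ≤ u n := by
    intro e he R
    obtain ⟨M, hM⟩ := he R
    refine ⟨_, summable_picard_bound |M| |κ| R, fun n t x hx => ?_⟩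
    refine (abs_picardTerm_le (fun t x hx => (hM t x hx).trans (le_abs_self M)) n t x hx).trans ?_
    gcongr
  have cont : ∀ e : ℝ → ℝ → ℝ, (∀ R, ∃ M, ∀ t x, |x| ≤ R → |e t x| ≤ M) →
      (∀ n, Continuous (Function.uncurry (picardTerm c₁ c₂ κ e n))) →
      Continuous (Function.uncurry fun t x => ∑' n, picardTerm c₁ c₂ κ e n t x) := by
    intro e he hc
    rw [continuous_iff_continuousAt]
    rintro ⟨t, x⟩
    -- The extra `1` makes the strip a neighbourhood of the point.
    obtain ⟨u, hu, hub⟩ := bound e he (|x| + 1)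
    have := continuousOn_tsum (s := {q : ℝ × ℝ | |q.2| ≤ |x| + 1})
      (f := fun n (q : ℝ × ℝ) => picardTerm c₁ c₂ κ e n q.1 q.2)
      (fun n => (hc n).continuousOn) hu (fun n q hq => hub n q.1 q.2 hq)
    refine this.continuousAt (Filter.mem_of_superset
      (IsOpen.mem_nhds (isOpen_lt (by fun_prop : Continuous fun q : ℝ × ℝ => |q.2|)
        (continuous_const (y := |x| + 1))) ?_) fun q hq => ?_)
    · simp
    · exact (le_of_lt hq : |q.2| ≤ |x| + 1)
  refine ⟨fun t x => ∑' n, p n t x, fun t x => ∑' n, p' n t x, ⟨?_, ?_, ?_⟩, ?_, ?_⟩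
  · exact cont d hd fun n => (hpart n).cont
  · exact cont d' hd' fun n => (hpart n).cont_deriv
  · intro t x
    obtain ⟨u, hu, hub⟩ := bound d hd |x|
    obtain ⟨v, hv, hvb⟩ := bound d' hd' |x|
    exact hasDerivAt_tsum hv (fun n s => (hpart n).deriv s x) (fun n s => hvb n s x le_rfl)
      (Summable.of_norm_bounded hu fun n => hub n t x le_rfl) t
  · intro t x
    obtain ⟨u, hu, hub⟩ := bound d hd |x|
    have hub' : ∀ n t y, |y| ≤ |x| → |charInt c₂ (p n) t y| ≤ u n * |x| := by
      intro n t y hy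
      have := abs_charInt_le c₂ (n := 0) (fun t y hy => by simpa using hub n t y hy) t y hy
      simp only [zero_add, pow_one, Nat.factorial_one, Nat.cast_one, div_one] at this
      exact this.trans (mul_le_mul_of_nonneg_left hy ((abs_nonneg _).trans (hub n t y hy)))
    have h2 : ∀ t y, |y| ≤ |x| → charInt c₂ (fun t x => ∑' n, p n t x) t y =
        ∑' n, charInt c₂ (p n) t y := fun t y hy =>
      (charInt_tsum c₂ (fun n => (hpart n).cont) hu hub t y hy).tsum_eq.symm
    have h1 := charInt_tsum c₁ (fun n => continuous_charInt c₂ (hpart n).cont)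
      (hu.mul_right |x|) hub' t x le_rfl
    have h3 : charInt c₁ (charInt c₂ fun t x => ∑' n, p n t x) t x =
        charInt c₁ (fun t x => ∑' n, charInt c₂ (p n) t x) t x := by
      refine intervalIntegral.integral_congr fun ξ hξ => h2 _ ξ ?_
      simpa using abs_sub_left_of_mem_uIcc hξ
    have hs : Summable fun n => p n t x := Summable.of_norm_bounded hu fun n => hub n t x le_rfl
    rw [h3, ← h1.tsum_eq, ← tsum_mul_left]
    exact hs.tsum_eq_zero_add
  -- `A` is closed under following both characteristics back to `x = 0`, so vanishing there passes
  -- from each iterate to the next.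
  · intro A hA
    have hn : ∀ n t x, A t x → p n t x = 0 := by
      intro n
      induction n with
      | zero => exact fun t x ht => (hA t x ht).2.1
      | succ n ih =>
        intro t x ht
        have : charInt c₁ (charInt c₂ (p n)) t x = 0 := by
          obtain ⟨hx, -, h12⟩ := hA t x ht
          refine charInt_eq_zero hx fun ξ hξ => ?_
          refine charInt_eq_zero hξ.1 fun η hη => ih _ _ ?_
          exact ((hA _ _ (h12 ξ hξ).1).2.2 η hη).2
        simp [hp, picardTerm] at this ⊢
        simp [this]
    intro t x ht
    simp [hn _ t x ht]

end Volterra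

/-! ### Explicit backstepping kernels -/

theorem HasPartials.comp_linear {f f₁ f₂ : ℝ → ℝ → ℝ} (h : HasPartials f f₁ f₂) (α β γ δ : ℝ) :
    HasPartials (fun x ξ => f (α * x + β * ξ) (γ * x + δ * ξ))
      (fun x ξ => f₁ (α * x + β * ξ) (γ * x + δ * ξ) * α + f₂ (α * x + β * ξ) (γ * x + δ * ξ) * γ)
      (fun x ξ => f₁ (α * x + β * ξ) (γ * x + δ * ξ) * β + f₂ (α * x + β * ξ) (γ * x + δ * ξ) * δ)
      where
  fst x ξ := by
    simpa using h.comp_curve (((hasDerivAt_id x).const_mul α).add_const (β * ξ))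
      (((hasDerivAt_id x).const_mul γ).add_const (δ * ξ))
  snd x ξ := by
    simpa using h.comp_curve (((hasDerivAt_id ξ).const_mul β).const_add (α * x))
      (((hasDerivAt_id ξ).const_mul δ).const_add (γ * x))
  cont_fst := by
    have h1 := h.cont_fst
    have h2 := h.cont_snd
    fun_prop
  cont_snd := by
    have h1 := h.cont_fst
    have h2 := h.cont_snd
    fun_prop

theorem HasPartials.const_mul {f f₁ f₂ : ℝ → ℝ → ℝ} (h : HasPartials f f₁ f₂) (k : ℝ) :
    HasPartials (fun t x => k * f t x) (fun t x => k * f₁ t x) (fun t x => k * f₂ t x) := by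
  have h1 := h.cont_fst
  have h2 := h.cont_snd
  exact ⟨fun t x => (h.fst t x).const_mul k, fun t x => (h.snd t x).const_mul k,
    by fun_prop, by fun_prop⟩

theorem HasPartials.add {f f₁ f₂ g g₁ g₂ : ℝ → ℝ → ℝ} (h : HasPartials f f₁ f₂)
    (hg : HasPartials g g₁ g₂) :
    HasPartials (fun t x => f t x + g t x) (fun t x => f₁ t x + g₁ t x)
      (fun t x => f₂ t x + g₂ t x) := by
  have h1 := h.cont_fst
  have h2 := h.cont_snd
  have h3 := hg.cont_fst
  have h4 := hg.cont_snd
  exact ⟨fun t x => (h.fst t x).add (hg.fst t x), fun t x => (h.snd t x).add (hg.snd t x),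
    by fun_prop, by fun_prop⟩

/-- Superposition of the exponentials `exp (z u + κ v / z)`, `|z| = R`, with weight `w z`. -/
noncomputable def expMean (κ R : ℝ) (w : ℂ → ℂ) (u v : ℝ) : ℝ :=
  (∫ θ in (0 : ℝ)..2 * Real.pi,
    Complex.exp (circleMap 0 R θ * u + κ * v / circleMap 0 R θ) * w (circleMap 0 R θ)).re

/-- Differentiation acts on the weight, by `z` in `u` and by `κ / z` in `v`. The two factors
multiply to the constant `κ`, which is what a first-order system in characteristic coordinates
requires. -/
theorem hasPartials_expMean (κ : ℝ) {R : ℝ} (hR : 0 < R) {w : ℂ → ℂ}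
    (hw : Continuous fun θ => w (circleMap 0 R θ)) :
    HasPartials (expMean κ R w) (expMean κ R fun z => z * w z)
      (expMean κ R fun z => κ / z * w z) := by
  have hz : ∀ θ, circleMap 0 R θ ≠ 0 := fun θ => circleMap_ne_center hR.ne'
  have hzc : Continuous fun θ => circleMap 0 R θ := continuous_circleMap 0 R
  have hzi : Continuous fun θ => (circleMap 0 R θ)⁻¹ := hzc.inv₀ hz
  have hcont : ∀ w' : ℂ → ℂ, (Continuous fun θ => w' (circleMap 0 R θ)) →
      Continuous (fun p : (ℝ × ℝ) × ℝ => Complex.exp (circleMap 0 R p.2 * p.1.1 +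
        κ * p.1.2 / circleMap 0 R p.2) * w' (circleMap 0 R p.2)) := by
    intro w' hw'
    simp only [div_eq_mul_inv]
    have h1 := hw'.comp (continuous_snd (X := ℝ × ℝ))
    have h2 := hzi.comp (continuous_snd (X := ℝ × ℝ))
    have h3 := hzc.comp (continuous_snd (X := ℝ × ℝ))
    exact (Complex.continuous_exp.comp ((h3.mul (by fun_prop)).add
      (Continuous.mul (by fun_prop) h2))).mul h1
  have hmean : ∀ w' : ℂ → ℂ, (Continuous fun θ => w' (circleMap 0 R θ)) →
      Continuous (Function.uncurry (expMean κ R w')) := fun w' hw' =>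
    Complex.continuous_re.comp
      (intervalIntegral.continuous_parametric_intervalIntegral_of_continuous'
        (f := fun (p : ℝ × ℝ) θ => Complex.exp (circleMap 0 R θ * p.1 +
        κ * p.2 / circleMap 0 R θ) * w' (circleMap 0 R θ)) (hcont w' hw') _ _)
  have hw1 : Continuous fun θ => circleMap 0 R θ * w (circleMap 0 R θ) := hzc.mul hw
  have hw2 : Continuous fun θ => κ / circleMap 0 R θ * w (circleMap 0 R θ) := by
    simp only [div_eq_mul_inv]; exact (continuous_const.mul hzi).mul hw
  refine ⟨fun u v => ?_, fun u v => ?_, hmean _ hw1, hmean _ hw2⟩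
  · have := hasDerivAt_integral_of_continuous
      (K := fun u θ => Complex.exp (circleMap 0 R θ * u + κ * v / circleMap 0 R θ) *
        w (circleMap 0 R θ))
      (K' := fun u θ => Complex.exp (circleMap 0 R θ * u + κ * v / circleMap 0 R θ) *
        (circleMap 0 R θ * w (circleMap 0 R θ)))
      ((hcont w hw).comp (g := fun p : (ℝ × ℝ) × ℝ => _) (f := fun q : ℝ × ℝ => ((q.1, v), q.2)) (by fun_prop))
      ((hcont (fun z => z * w z) hw1).comp (f := fun q : ℝ × ℝ => ((q.1, v), q.2)) (by fun_prop))
      (fun s θ => by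
        have h1 : HasDerivAt (fun s : ℝ => circleMap 0 R θ * (s : ℂ) + κ * v / circleMap 0 R θ)
            (circleMap 0 R θ * 1) s :=
          ((Complex.ofRealCLM.hasDerivAt (x := s)).const_mul _).add_const _
        convert! (h1.cexp.mul_const (w (circleMap 0 R θ))) using 1
        ring) 0 (2 * Real.pi) u
    exact Complex.reCLM.hasFDerivAt.comp_hasDerivAt u this
  · have := hasDerivAt_integral_of_continuous
      (K := fun v θ => Complex.exp (circleMap 0 R θ * u + κ * v / circleMap 0 R θ) *
        w (circleMap 0 R θ))
      (K' := fun v θ => Complex.exp (circleMap 0 R θ * u + κ * v / circleMap 0 R θ) *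
        (κ / circleMap 0 R θ * w (circleMap 0 R θ)))
      ((hcont w hw).comp (f := fun q : ℝ × ℝ => ((u, q.1), q.2)) (by fun_prop))
      ((hcont (fun z => κ / z * w z) hw2).comp (f := fun q : ℝ × ℝ => ((u, q.1), q.2)) (by fun_prop))
      (fun s θ => by
        have h1 : HasDerivAt (fun s : ℝ => circleMap 0 R θ * (u : ℂ) +
            κ * (s : ℂ) / circleMap 0 R θ) (κ * 1 / circleMap 0 R θ) s :=
          (((Complex.ofRealCLM.hasDerivAt (x := s)).const_mul _).div_const _).const_add _
        convert! (h1.cexp.mul_const (w (circleMap 0 R θ))) using 1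
        ring) 0 (2 * Real.pi) v
    exact Complex.reCLM.hasFDerivAt.comp_hasDerivAt v this

/-- The weight for which `expMean` solves the boundary conditions of the kernels. -/
noncomputable def kernelWeight (A κ : ℝ) (z : ℂ) : ℂ := (z ^ 2 - κ) / (z * (z + A))

theorem circleMap_add_ne_zero {A R : ℝ} (hR : |A| < R) (θ : ℝ) : circleMap 0 R θ + A ≠ 0 := by
  intro h
  have h1 : ‖circleMap 0 R θ‖ = ‖(A : ℂ)‖ := by rw [eq_neg_of_add_eq_zero_left h, norm_neg]
  rw [norm_circleMap_zero, Complex.norm_real, Real.norm_eq_abs,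
    abs_of_pos ((abs_nonneg A).trans_lt hR)] at h1
  exact hR.ne h1.symm

theorem continuous_kernelWeight {A κ R : ℝ} (hR : |A| < R) :
    Continuous fun θ => kernelWeight A κ (circleMap 0 R θ) := by
  have hzc : Continuous fun θ => circleMap 0 R θ := continuous_circleMap 0 R
  unfold kernelWeight
  refine Continuous.div (by fun_prop) (by fun_prop) fun θ => mul_ne_zero ?_ ?_
  · exact circleMap_ne_center ((abs_nonneg A).trans_lt hR).ne'
  · exact circleMap_add_ne_zero hR θ

/-- For `u = 0` the integrand is holomorphic outside the circle, whose radius exceeds `|A|`, and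
tends to `1` at infinity. Its mean over the circle is this value at infinity. -/
theorem expMean_kernelWeight_diag {A κ R : ℝ} (hR : |A| < R) (v : ℝ) :
    expMean κ R (kernelWeight A κ) 0 v = 2 * Real.pi := by
  have hR0 : 0 < R := (abs_nonneg A).trans_lt hR
  -- The integrand in the variable `s = 1 / z`, which brings infinity to `0`, where the mean value
  -- property applies.
  set G : ℂ → ℂ := fun s => Complex.exp (κ * v * s) * ((1 - κ * s ^ 2) / (1 + A * s)) with hG
  have hne : ∀ s ∈ Metric.closedBall (0 : ℂ) R⁻¹, 1 + A * s ≠ 0 := by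
    intro s hs h
    have h1 : ‖(A : ℂ) * s‖ = 1 := by
      rw [eq_neg_of_add_eq_zero_right h]; simp
    rw [norm_mul, Complex.norm_real, Real.norm_eq_abs] at h1
    have h2 : ‖s‖ ≤ R⁻¹ := by simpa using hs
    have : |A| * ‖s‖ < 1 := by
      calc |A| * ‖s‖ ≤ |A| * R⁻¹ := by gcongr
        _ < R * R⁻¹ := by gcongr
        _ = 1 := mul_inv_cancel₀ hR0.ne'
    linarith
  have hmv : Real.circleAverage G 0 R⁻¹ = G 0 := by
    apply DiffContOnCl.circleAverage
    apply DifferentiableOn.diffContOnCl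
    rw [abs_of_pos (inv_pos.2 hR0)]
    intro s hs
    have := hne s (Metric.closure_ball_subset_closedBall hs)
    exact (by fun_prop (disch := assumption) : DifferentiableAt ℂ G s).differentiableWithinAt
  -- Both averages are scaled to the unit circle, on which inversion preserves averages.
  have hinv : Real.circleAverage G 0 R⁻¹ =
      Real.circleAverage (fun z => Complex.exp (κ * v / z) * kernelWeight A κ z) 0 R := by
    rw [Real.circleAverage_eq_circleAverage_zero_one (f := G),
      ← Real.circleAverage_zero_one_congr_inv,
      Real.circleAverage_eq_circleAverage_zero_one (R := R)]
    refine Real.circleAverage_congr_sphere fun z hz => ?_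
    have hz0 : z ≠ 0 := by
      rintro rfl
      simp at hz
    have hR' : (R : ℂ) ≠ 0 := by exact_mod_cast hR0.ne'
    have hzA : R * z + A ≠ 0 := by
      intro h
      have h1 : ‖(R : ℂ) * z‖ = ‖(A : ℂ)‖ := by rw [eq_neg_of_add_eq_zero_left h, norm_neg]
      have h2 : ‖z‖ = 1 := by simpa using hz
      rw [norm_mul, h2, Complex.norm_real, Complex.norm_real, Real.norm_eq_abs, Real.norm_eq_abs,
        abs_of_pos hR0, mul_one] at h1
      exact hR.ne h1.symm
    have e1 : (κ * v * (((R⁻¹ : ℝ) : ℂ) * z⁻¹ + 0)) = κ * v / (R * z + 0) := by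
      push_cast; field_simp; ring
    have e2 : 1 + A * (((R⁻¹ : ℝ) : ℂ) * z⁻¹ + 0) = (R * z + A) / (R * z) := by
      push_cast; field_simp; ring
    simp only [hG, kernelWeight, e1, e2]
    congr 1
    push_cast
    simp only [add_zero]
    field_simp
  rw [hinv, Real.circleAverage_def] at hmv
  have h0 : G 0 = 1 := by simp [hG]
  rw [h0] at hmv
  have h2 := congrArg Complex.re hmv
  simp only [Complex.smul_re, Complex.one_re, smul_eq_mul] at h2
  unfold expMean
  have : (2 * Real.pi) ≠ 0 := by positivity
  field_simp at h2
  simpa using h2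

/-- The weight is chosen so that `(z + A) w(z) = z - κ / z`. On `u = v` this turns the integrand
into a multiple of the `θ`-derivative of `exp (u (z + κ / z))`, whose integral over a period is
zero. -/
theorem expMean_kernelWeight_left {A κ R : ℝ} (hR : |A| < R) (u : ℝ) :
    expMean κ R (fun z => z * kernelWeight A κ z) u u = -A * expMean κ R (kernelWeight A κ) u u := by
  have hR0 : 0 < R := (abs_nonneg A).trans_lt hR
  have hz : ∀ θ, circleMap 0 R θ ≠ 0 := fun θ => circleMap_ne_center hR0.ne'
  have hzc : Continuous fun θ => circleMap 0 R θ := continuous_circleMap 0 R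
  have hw := continuous_kernelWeight (κ := κ) hR
  set E : ℝ → ℂ := fun θ => Complex.exp (circleMap 0 R θ * u + κ * u / circleMap 0 R θ) with hE
  have hEc : Continuous E := by
    have hzi : Continuous fun θ => (circleMap 0 R θ)⁻¹ := hzc.inv₀ hz
    simp only [hE, div_eq_mul_inv]
    fun_prop
  have key : ∫ θ in (0 : ℝ)..2 * Real.pi, E θ * (circleMap 0 R θ - κ / circleMap 0 R θ) = 0 := by
    have hd : ∀ θ, HasDerivAt (fun θ => circleMap 0 R θ + κ / circleMap 0 R θ)
        ((circleMap 0 R θ - κ / circleMap 0 R θ) * Complex.I) θ := by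
      intro θ
      have h1 := hasDerivAt_circleMap 0 R θ
      convert! h1.add ((h1.inv (hz θ)).const_mul (κ : ℂ)) using 1
      have := hz θ
      field_simp
      ring
    have hper : circleMap 0 R (2 * Real.pi) = circleMap 0 R 0 := by
      simpa using periodic_circleMap 0 R 0
    have hint : Continuous fun θ => circleMap 0 R θ - κ / circleMap 0 R θ := by
      have hzi : Continuous fun θ => (circleMap 0 R θ)⁻¹ := hzc.inv₀ hz
      simp only [div_eq_mul_inv]
      fun_prop
    -- The primitive of the integrand carries a factor `1 / u`; for `u = 0` the primitive is `z + κ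
    -- / z` itself, up to a constant factor.
    rcases eq_or_ne u 0 with rfl | hu
    · have := intervalIntegral.integral_eq_sub_of_hasDerivAt (a := 0) (b := 2 * Real.pi)
        (fun θ _ => hd θ) ((hint.mul continuous_const).intervalIntegrable _ _)
      rw [hper, sub_self, intervalIntegral.integral_mul_const] at this
      simpa [hE] using this
    · have hd' : ∀ θ, HasDerivAt E
          (E θ * (circleMap 0 R θ - κ / circleMap 0 R θ) * (Complex.I * u)) θ := by
        intro θ
        convert! ((hd θ).mul_const (u : ℂ)).cexp using 1
        · simp only [hE]; ext θ; congr 1; ring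
        · simp only [hE]
          rw [show (circleMap 0 R θ + κ / circleMap 0 R θ) * (u : ℂ) =
            circleMap 0 R θ * u + κ * u / circleMap 0 R θ by ring]
          ring
      have := intervalIntegral.integral_eq_sub_of_hasDerivAt (a := 0) (b := 2 * Real.pi)
        (fun θ _ => hd' θ) (((hEc.mul hint).mul continuous_const).intervalIntegrable _ _)
      have hEper : E (2 * Real.pi) = E 0 := by simp only [hE, hper]
      rw [hEper, sub_self, intervalIntegral.integral_mul_const] at this
      simpa [hu] using this
  have hsum : (∫ θ in (0 : ℝ)..2 * Real.pi,
        E θ * (circleMap 0 R θ * kernelWeight A κ (circleMap 0 R θ))) +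
      (A : ℂ) * ∫ θ in (0 : ℝ)..2 * Real.pi, E θ * kernelWeight A κ (circleMap 0 R θ) = 0 := by
    rw [← intervalIntegral.integral_const_mul, ← intervalIntegral.integral_add]
    · refine Eq.trans (intervalIntegral.integral_congr fun θ _ => ?_) key
      have h1 := hz θ
      have h2 := circleMap_add_ne_zero hR θ
      simp only [kernelWeight]
      field_simp
    · exact (hEc.mul (hzc.mul hw)).intervalIntegrable _ _
    · exact (continuous_const.mul (hEc.mul hw)).intervalIntegrable _ _
  have := congrArg Complex.re hsum
  rw [Complex.add_re, Complex.re_ofReal_mul] at this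
  simp only [Complex.zero_re] at this
  unfold expMean
  linarith

theorem exists_isBacksteppingKernel {lam : ℝ} (hlam : 0 < lam) (a b L : ℝ) :
    ∃ P₁ P₂, IsBacksteppingKernel lam a b L P₁ P₂ := by
  set A := a / (1 + lam) with hA
  set κ := A * (b / (lam * (1 + lam))) with hκ
  have hR : |A| < |A| + 1 := by linarith
  have hR0 : 0 < |A| + 1 := by positivity
  have hw := continuous_kernelWeight (κ := κ) hR
  have hw1 : Continuous fun θ => circleMap 0 (|A| + 1) θ * kernelWeight A κ (circleMap 0 (|A| + 1) θ) :=
    (continuous_circleMap 0 _).mul hw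
  set R := |A| + 1
  -- Characteristic coordinates `u = ξ - x`, `v = lam x + ξ`: the operators of the two kernel
  -- equations become `(1 + lam) ∂ᵤ` and `lam (1 + lam) ∂ᵥ`. This fixes the prefactor `-A` and the
  -- value of `κ`. The diagonal is `u = 0` and the edge `x = 0` is `u = v`.
  have hF := ((hasPartials_expMean κ hR0 hw).comp_linear (-1) 1 lam 1).const_mul (-A / (2 * Real.pi))
  have hG := ((hasPartials_expMean κ hR0 (w := fun z => z * kernelWeight A κ z) hw1).comp_linear
    (-1) 1 lam 1).const_mul (1 / (2 * Real.pi))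
  have hcancel : ∀ u v, expMean κ R (fun z => κ / z * (z * kernelWeight A κ z)) u v =
      κ * expMean κ R (kernelWeight A κ) u v := by
    intro u v
    unfold expMean
    rw [← Complex.re_ofReal_mul, ← intervalIntegral.integral_const_mul]
    congr 1
    refine intervalIntegral.integral_congr fun θ _ => ?_
    dsimp only
    have h1 : circleMap 0 R θ ≠ 0 := circleMap_ne_center hR0.ne'
    field_simp
  refine ⟨_, _, hF.contDiff, hG.contDiff, ?_, ?_, ?_, ?_⟩
  · intro x ξ _ _ _
    rw [(hF.fst x ξ).deriv, (hF.snd x ξ).deriv]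
    simp only [hA]
    field_simp
    ring
  · intro x ξ _ _ _
    rw [(hG.fst x ξ).deriv, (hG.snd x ξ).deriv, hcancel, hκ]
    field_simp
    ring
  · intro x _ _
    rw [show -1 * x + 1 * x = 0 by ring, expMean_kernelWeight_diag hR, hA]
    have := Real.pi_ne_zero
    field_simp
  · intro ξ _ _
    simp only [mul_zero, zero_add, one_mul]
    rw [expMean_kernelWeight_left hR]
    ring

/-! ### The Volterra transform of the adjoint system -/

theorem hasPartials_of_contDiff {f : ℝ → ℝ → ℝ} (h : ContDiff ℝ 1 (Function.uncurry f)) :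
    HasPartials f (fun t x => deriv (fun s => f s x) t) (fun t x => deriv (fun z => f t z) x) := by
  have hd : Differentiable ℝ (Function.uncurry f) := h.differentiable one_ne_zero
  have h1 : ∀ t x, HasDerivAt (fun s => f s x) (fderiv ℝ (Function.uncurry f) (t, x) (1, 0)) t :=
    fun t x => HasFDerivAt.comp_hasDerivAt (f := fun s => (s, x)) t (hd (t, x)).hasFDerivAt
      ((hasDerivAt_id t).prodMk (hasDerivAt_const t x))
  have h2 : ∀ t x, HasDerivAt (fun z => f t z) (fderiv ℝ (Function.uncurry f) (t, x) (0, 1)) x :=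
    fun t x => HasFDerivAt.comp_hasDerivAt (f := fun z => (t, z)) x (hd (t, x)).hasFDerivAt
      ((hasDerivAt_const x t).prodMk (hasDerivAt_id x))
  have hc := h.continuous_fderiv one_ne_zero
  refine ⟨fun t x => (h1 t x).differentiableAt.hasDerivAt,
    fun t x => (h2 t x).differentiableAt.hasDerivAt, ?_, ?_⟩
  · simp only [(h1 _ _).deriv]
    exact (hc.clm_apply continuous_const)
  · simp only [(h2 _ _).deriv]
    exact (hc.clm_apply continuous_const)

/-- If `φ` solves the adjoint system with sources `S₁`, `S₂`, its Volterra transform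
`φ₂ + ∫₀ˣ (P₁ φ₁ + P₂ φ₂)` is transported along the characteristics of speed `lam`, up to sources. -/
theorem IsBacksteppingKernel.transform_eq {lam a b L : ℝ} {P₁ P₂ : ℝ → ℝ → ℝ}
    (hP : IsBacksteppingKernel lam a b L P₁ P₂) (hlam : 0 < lam) (hL : 0 < L)
    {φ₁ φ₁t φ₁x φ₂ φ₂t φ₂x S₁ S₂ : ℝ → ℝ → ℝ}
    (h₁ : HasPartials φ₁ φ₁t φ₁x) (h₂ : HasPartials φ₂ φ₂t φ₂x)
    (hS₁ : Continuous (Function.uncurry S₁)) (hS₂ : Continuous (Function.uncurry S₂))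
    (e₁ : ∀ t x, φ₁t t x - φ₁x t x = b * φ₂ t x + S₁ t x)
    (e₂ : ∀ t x, φ₂t t x + lam * φ₂x t x = a * φ₁ t x + S₂ t x)
    (e₀ : ∀ t, φ₁ t 0 = lam * φ₂ t 0) (t₀ : ℝ) :
    lam * (φ₂ (t₀ + L / lam) L +
      ∫ ξ in (0 : ℝ)..L, (P₁ ξ L * φ₁ (t₀ + L / lam) ξ + P₂ ξ L * φ₂ (t₀ + L / lam) ξ)) =
    lam * φ₂ t₀ 0 + ∫ x in (0 : ℝ)..L, (S₂ (t₀ + x / lam) x +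
      ∫ ξ in (0 : ℝ)..x, (P₁ ξ x * S₁ (t₀ + x / lam) ξ + P₂ ξ x * S₂ (t₀ + x / lam) ξ)) := by
  have p₁ := hasPartials_of_contDiff hP.contDiff_fst
  have p₂ := hasPartials_of_contDiff hP.contDiff_snd
  set P₁x := fun t x => deriv (fun s => P₁ s x) t with hP₁x
  set P₁ξ := fun t x => deriv (fun z => P₁ t z) x with hP₁ξ
  set P₂x := fun t x => deriv (fun s => P₂ s x) t with hP₂x
  set P₂ξ := fun t x => deriv (fun z => P₂ t z) x with hP₂ξ
  have cP₁ := p₁.cont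
  have cP₂ := p₂.cont
  have cP₁x := p₁.cont_fst
  have cP₁ξ := p₁.cont_snd
  have cP₂x := p₂.cont_fst
  have cP₂ξ := p₂.cont_snd
  have c₁ := h₁.cont
  have c₂ := h₂.cont
  have c₁t := h₁.cont_fst
  have c₂t := h₂.cont_fst
  have c₁x := h₁.cont_snd
  have c₂x := h₂.cont_snd
  have hline : ∀ x, HasDerivAt (fun x => t₀ + x / lam) (1 / lam) x := fun x =>
    ((hasDerivAt_id x).div_const lam).const_add t₀
  set k : ℝ → ℝ → ℝ := fun x ξ =>
    P₁ ξ x * φ₁ (t₀ + x / lam) ξ + P₂ ξ x * φ₂ (t₀ + x / lam) ξ with hk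
  set k' : ℝ → ℝ → ℝ := fun x ξ =>
    (P₁ξ ξ x * φ₁ (t₀ + x / lam) ξ + P₁ ξ x * (φ₁t (t₀ + x / lam) ξ * (1 / lam))) +
    (P₂ξ ξ x * φ₂ (t₀ + x / lam) ξ + P₂ ξ x * (φ₂t (t₀ + x / lam) ξ * (1 / lam))) with hk'
  have hkp : HasFstPartial k k' := by
    refine ⟨by fun_prop, by fun_prop, fun x ξ => ?_⟩
    have d₁ := h₁.comp_curve (hline x) (hasDerivAt_const x ξ)
    have d₂ := h₂.comp_curve (hline x) (hasDerivAt_const x ξ)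
    simp only [mul_zero, add_zero] at d₁ d₂
    exact ((p₁.snd ξ x).mul d₁).add ((p₂.snd ξ x).mul d₂)
  set m : ℝ → ℝ := fun x => φ₂ (t₀ + x / lam) x + ∫ ξ in (0 : ℝ)..x, k x ξ with hm
  set S : ℝ → ℝ := fun x => S₂ (t₀ + x / lam) x +
      ∫ ξ in (0 : ℝ)..x, (P₁ ξ x * S₁ (t₀ + x / lam) ξ + P₂ ξ x * S₂ (t₀ + x / lam) ξ) with hS
  have hScont : Continuous S := by
    have : Continuous fun x => ∫ ξ in (0 : ℝ)..x,
        (P₁ ξ x * S₁ (t₀ + x / lam) ξ + P₂ ξ x * S₂ (t₀ + x / lam) ξ) :=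
      intervalIntegral.continuous_parametric_intervalIntegral_of_continuous
        (f := fun x ξ => P₁ ξ x * S₁ (t₀ + x / lam) ξ + P₂ ξ x * S₂ (t₀ + x / lam) ξ)
        (by fun_prop) continuous_id
    fun_prop
  have hmd : ∀ x ∈ Icc 0 L, HasDerivAt m (S x / lam) x := by
    intro x hx
    have hd := (h₂.comp_curve (hline x) (hasDerivAt_id x)).add (hkp.hasDerivAt_diag_primitive x)
    refine hd.congr_deriv ?_
    simp only [id, mul_one]
    set t := t₀ + x / lam with ht
    -- The adjoint equations trade `t`-derivatives of `φ` for `ξ`-derivatives, and the kernel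
    -- equations supply the matching derivatives of `Pᵢ`. Apart from sources, `lam * k'` is thus
    -- this exact derivative.
    have hG : ∀ ξ, HasDerivAt (fun ξ => P₁ ξ x * φ₁ t ξ - lam * (P₂ ξ x * φ₂ t ξ))
        ((P₁x ξ x * φ₁ t ξ + P₁ ξ x * φ₁x t ξ) -
          lam * (P₂x ξ x * φ₂ t ξ + P₂ ξ x * φ₂x t ξ)) ξ := fun ξ =>
      ((p₁.fst ξ x).mul (h₁.snd t ξ)).sub (((p₂.fst ξ x).mul (h₂.snd t ξ)).const_mul lam)
    have hFTC := intervalIntegral.integral_eq_sub_of_hasDerivAt (a := 0) (b := x)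
      (fun ξ _ => hG ξ) ((by fun_prop : Continuous fun ξ =>
        (P₁x ξ x * φ₁ t ξ + P₁ ξ x * φ₁x t ξ) -
          lam * (P₂x ξ x * φ₂ t ξ + P₂ ξ x * φ₂x t ξ)).intervalIntegrable _ _)
    have hint : lam * ∫ ξ in (0 : ℝ)..x, k' x ξ =
        (∫ ξ in (0 : ℝ)..x, ((P₁x ξ x * φ₁ t ξ + P₁ ξ x * φ₁x t ξ) -
          lam * (P₂x ξ x * φ₂ t ξ + P₂ ξ x * φ₂x t ξ))) +
        ∫ ξ in (0 : ℝ)..x, (P₁ ξ x * S₁ t ξ + P₂ ξ x * S₂ t ξ) := by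
      rw [← intervalIntegral.integral_const_mul, ← intervalIntegral.integral_add]
      · refine intervalIntegral.integral_congr fun ξ hξ => ?_
        rw [uIcc_of_le hx.1] at hξ
        have q₁ : lam * P₁ξ ξ x - P₁x ξ x + a * P₂ ξ x = 0 := hP.eq_fst ξ x hξ.1 hξ.2 hx.2
        have q₂ : lam * P₂x ξ x + lam * P₂ξ ξ x + b * P₁ ξ x = 0 := hP.eq_snd ξ x hξ.1 hξ.2 hx.2
        simp only [hk', ← ht]
        field_simp
        linear_combination (φ₁ t ξ) * q₁ + (φ₂ t ξ) * q₂ + P₁ ξ x * e₁ t ξ + P₂ ξ x * e₂ t ξ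
      · exact (by fun_prop : Continuous _).intervalIntegrable _ _
      · exact (by fun_prop : Continuous _).intervalIntegrable _ _
    have hdiag := hP.diag x hx.1 hx.2
    have hleft := hP.left x hx.1 hx.2
    rw [hFTC] at hint
    have h1lam : 1 + lam ≠ 0 := by positivity
    have hdiag' : (1 + lam) * P₁ x x = -a := by rw [hdiag]; field_simp
    rw [eq_div_iff hlam.ne']
    simp only [hS, ← ht]
    have hkx : k x x = P₁ x x * φ₁ t x + P₂ x x * φ₂ t x := by simp only [hk, ← ht]
    rw [hkx]
    have e0t := e₀ t
    have e2t := e₂ t x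
    have : φ₂t t x * (1 / lam) * lam = φ₂t t x := by field_simp
    -- At `ξ = x` the coefficient of `φ₁` is `a + (1 + lam) P₁(x, x) = 0` and the `P₂` terms cancel;
    -- at `ξ = 0` the edge condition on the kernels matches `φ₁ = lam φ₂`.
    linear_combination this + hint + e2t + φ₁ t x * hdiag' - P₁ 0 x * e0t - lam * φ₂ t 0 * hleft
  have hFTC := intervalIntegral.integral_eq_sub_of_hasDerivAt (a := 0) (b := L)
    (fun x hx => hmd x (by rwa [uIcc_of_le hL.le] at hx))
    ((hScont.div_const lam).intervalIntegrable _ _)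
  rw [intervalIntegral.integral_div, div_eq_iff hlam.ne'] at hFTC
  have hm0 : m 0 = φ₂ t₀ 0 := by simp [hm]
  have hmL : m L = φ₂ (t₀ + L / lam) L + ∫ ξ in (0 : ℝ)..L,
    (P₁ ξ L * φ₁ (t₀ + L / lam) ξ + P₂ ξ L * φ₂ (t₀ + L / lam) ξ) := rfl
  rw [hFTC, ← hmL, ← hm0]
  ring

/-! ### The adjoint system as an evolution in `x` -/

/-- Bounded on every strip `|x| ≤ R`. -/
def BddOnStrips (f : ℝ → ℝ → ℝ) : Prop := ∀ R, ∃ M, ∀ t x, |x| ≤ R → |f t x| ≤ M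

theorem BddOnStrips.add {f g : ℝ → ℝ → ℝ} (hf : BddOnStrips f) (hg : BddOnStrips g) :
    BddOnStrips fun t x => f t x + g t x := fun R => by
  obtain ⟨M, hM⟩ := hf R
  obtain ⟨N, hN⟩ := hg R
  exact ⟨M + N, fun t x hx => (abs_add_le _ _).trans (add_le_add (hM t x hx) (hN t x hx))⟩

theorem BddOnStrips.const_mul {f : ℝ → ℝ → ℝ} (hf : BddOnStrips f) (k : ℝ) :
    BddOnStrips fun t x => k * f t x := fun R => by
  obtain ⟨M, hM⟩ := hf R
  exact ⟨|k| * M, fun t x hx => by rw [abs_mul]; gcongr; exact hM t x hx⟩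

theorem BddOnStrips.charInt {f : ℝ → ℝ → ℝ} (hf : BddOnStrips f) (c : ℝ) :
    BddOnStrips (charInt c f) := fun R => by
  obtain ⟨M, hM⟩ := hf R
  refine ⟨M * R, fun t x hx => ?_⟩
  have := abs_charInt_le c (n := 0) (fun t x hx => by simpa using hM t x hx) t x hx
  simp only [zero_add, pow_one, Nat.factorial_one, Nat.cast_one, div_one] at this
  exact this.trans (mul_le_mul_of_nonneg_left hx ((abs_nonneg _).trans (hM t x hx)))

theorem BddOnStrips.of_mul {χ σ : ℝ → ℝ} (hχ : ∃ C, ∀ t, |χ t| ≤ C) (hσ : Continuous σ) :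
    BddOnStrips fun t x => χ t * σ x := fun R => by
  obtain ⟨C, hC⟩ := hχ
  obtain ⟨M, hM⟩ := (isCompact_Icc (a := -R) (b := R)).exists_bound_of_continuousOn hσ.continuousOn
  refine ⟨C * M, fun t x hx => ?_⟩
  rw [abs_mul]
  exact mul_le_mul (hC t) (hM x (abs_le.1 hx)) (abs_nonneg _) ((abs_nonneg _).trans (hC t))

theorem BddOnStrips.of_wave {g : ℝ → ℝ} (hg : ∃ C, ∀ t, |g t| ≤ C) (c : ℝ) :
    BddOnStrips fun t x => g (t + c * x) := fun _ => by
  obtain ⟨C, hC⟩ := hg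
  exact ⟨C, fun t x _ => hC _⟩

theorem hasPartials_wave {g g' : ℝ → ℝ} (hg : ∀ t, HasDerivAt g (g' t) t) (hg' : Continuous g')
    (c : ℝ) : HasPartials (fun t x => g (t + c * x)) (fun t x => g' (t + c * x))
      (fun t x => g' (t + c * x) * c) where
  fst t x := (hg _).comp_add_const t (c * x)
  snd t x := by
    have h1 : HasDerivAt (fun x => t + c * x) c x := by
      simpa using ((hasDerivAt_id x).const_mul c).const_add t
    exact (hg (t + c * x)).comp x h1
  cont_fst := by fun_prop
  cont_snd := by fun_prop

theorem hasFstPartial_mul {χ χ' σ : ℝ → ℝ} (hχ : ∀ t, HasDerivAt χ (χ' t) t)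
    (hχ' : Continuous χ') (hσ : Continuous σ) :
    HasFstPartial (fun t x => χ t * σ x) (fun t x => χ' t * σ x) := by
  have hc : Continuous χ := continuous_iff_continuousAt.2 fun t => (hχ t).continuousAt
  exact ⟨by fun_prop, by fun_prop, fun t x => (hχ t).mul_const (σ x)⟩

theorem charInt_add_const_mul (c k : ℝ) {f g : ℝ → ℝ → ℝ} (hf : Continuous (Function.uncurry f))
    (hg : Continuous (Function.uncurry g)) (t x : ℝ) :
    charInt c (fun t x => f t x + k * g t x) t x = charInt c f t x + k * charInt c g t x := by
  unfold charInt
  rw [← intervalIntegral.integral_const_mul, ← intervalIntegral.integral_add]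
  · exact (by fun_prop : Continuous _).intervalIntegrable _ _
  · exact (by fun_prop : Continuous _).intervalIntegrable _ _

/-- Solvability of the adjoint Cauchy problem from `x = 0` with data `(lam g, g)` and sources
`χ σ₁`, `χ σ₂`. -/
theorem exists_adjoint_cauchy {lam : ℝ} (hlam : 0 < lam) (a b : ℝ) {g g' χ χ' σ₁ σ₂ : ℝ → ℝ}
    (hg : ∀ t, HasDerivAt g (g' t) t) (cg' : Continuous g')
    (bg : ∃ C, ∀ t, |g t| ≤ C) (bg' : ∃ C, ∀ t, |g' t| ≤ C)
    (hχ : ∀ t, HasDerivAt χ (χ' t) t) (cχ' : Continuous χ')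
    (bχ : ∃ C, ∀ t, |χ t| ≤ C) (bχ' : ∃ C, ∀ t, |χ' t| ≤ C)
    (hσ₁ : Continuous σ₁) (hσ₂ : Continuous σ₂) :
    ∃ φ₁ φ₁t φ₁x φ₂ φ₂t φ₂x : ℝ → ℝ → ℝ,
      HasPartials φ₁ φ₁t φ₁x ∧ HasPartials φ₂ φ₂t φ₂x ∧
      (∀ t x, φ₁t t x - φ₁x t x = b * φ₂ t x + χ t * σ₁ x) ∧
      (∀ t x, φ₂t t x + lam * φ₂x t x = a * φ₁ t x + χ t * σ₂ x) ∧
      (∀ t, φ₁ t 0 = lam * g t) ∧ (∀ t, φ₂ t 0 = g t) ∧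
      ∀ A : ℝ → ℝ → Prop, (∀ t x, A t x → 0 ≤ x ∧ χ t = 0 ∧ g (t + x) = 0 ∧
        g (t + -1 / lam * x) = 0 ∧
        ∀ ξ ∈ Icc 0 x, A (t + 1 * (x - ξ)) ξ ∧ A (t + -1 / lam * (x - ξ)) ξ) →
        ∀ t x, A t x → φ₁ t x = 0 ∧ φ₂ t x = 0 := by
  set c := -1 / lam with hc
  have hlc : lam * c = -1 := by rw [hc]; field_simp
  set S₁ : ℝ → ℝ → ℝ := fun t x => χ t * σ₁ x with hS₁
  set S₂ : ℝ → ℝ → ℝ := fun t x => χ t * σ₂ x with hS₂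
  have pS₁ := hasFstPartial_mul hχ cχ' hσ₁
  have pS₂ := hasFstPartial_mul hχ cχ' hσ₂
  have w₁ := hasPartials_wave hg cg' 1
  have w₂ := hasPartials_wave hg cg' c
  have pq := w₂.hasFstPartial.add ((pS₂.charInt c).hasFstPartial.const_mul (1 / lam))
  have bq := (BddOnStrips.of_wave bg c).add (((BddOnStrips.of_mul bχ hσ₂).charInt c).const_mul (1 / lam))
  have bq' := (BddOnStrips.of_wave bg' c).add
    (((BddOnStrips.of_mul bχ' hσ₂).charInt c).const_mul (1 / lam))
  -- `q` is the part of `φ₂` that does not involve `φ₁`. Substituting the formula for `φ₂` into that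
  -- for `φ₁` leaves a scalar Volterra equation for `φ₁`.
  set q : ℝ → ℝ → ℝ := fun t x => g (t + c * x) + 1 / lam * charInt c S₂ t x with hq
  have pd := (w₁.hasFstPartial.const_mul lam).add (((pS₁.charInt 1).hasFstPartial.const_mul (-1)).add
    ((pq.charInt 1).hasFstPartial.const_mul (-b)))
  have bd := ((BddOnStrips.of_wave bg 1).const_mul lam).add
    ((((BddOnStrips.of_mul bχ hσ₁).charInt 1).const_mul (-1)).add ((bq.charInt 1).const_mul (-b)))
  have bd' := ((BddOnStrips.of_wave bg' 1).const_mul lam).add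
    ((((BddOnStrips.of_mul bχ' hσ₁).charInt 1).const_mul (-1)).add ((bq'.charInt 1).const_mul (-b)))
  obtain ⟨φ₁, φ₁', hφ₁, heq, hvan⟩ := exists_volterra_solution 1 c (-b * (a / lam)) pd bd bd'
  have hφ₁c := hφ₁.cont
  have hS₁c := pS₁.cont
  have hS₂c := pS₂.cont
  have hqc := pq.cont
  have ph₂ := pS₂.add (hφ₁.const_mul a)
  have P2 := w₂.add ((ph₂.charInt c).const_mul (1 / lam))
  set φ₂ : ℝ → ℝ → ℝ := fun t x =>
    g (t + c * x) + 1 / lam * charInt c (fun t x => S₂ t x + a * φ₁ t x) t x with hφ₂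
  have ph₁ := (pS₁.const_mul (-1)).add (P2.hasFstPartial.const_mul (-b))
  have P1 := (w₁.const_mul lam).add (ph₁.charInt 1)
  have hφ₂q : ∀ t x, φ₂ t x = q t x + a / lam * charInt c φ₁ t x := by
    intro t x
    simp only [hφ₂, hq]
    rw [charInt_add_const_mul c a hS₂c hφ₁c]
    ring
  -- Writing `φ₁` again as a characteristic integral yields its `x`-derivative, which the Volterra
  -- solution does not provide directly.
  have hφ₁eq : (fun t x => lam * g (t + 1 * x) +
      charInt 1 (fun t x => -1 * S₁ t x + -b * φ₂ t x) t x) = φ₁ := by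
    ext t x
    rw [heq, charInt_add_const_mul 1 (-b) (by fun_prop) P2.cont]
    have e1 : charInt 1 (fun t x => -1 * S₁ t x) t x = -1 * charInt 1 S₁ t x := by
      unfold charInt; rw [intervalIntegral.integral_const_mul]
    have e2 : charInt 1 φ₂ t x = charInt 1 q t x + a / lam * charInt 1 (charInt c φ₁) t x := by
      rw [← charInt_add_const_mul 1 (a / lam) hqc (continuous_charInt c hφ₁c)]
      congr 1
      ext t x
      exact hφ₂q t x
    rw [e1, e2]
    ring
  rw [hφ₁eq] at P1
  refine ⟨φ₁, _, _, φ₂, _, _, P1, P2, ?_, ?_, ?_, ?_, ?_⟩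
  · intro t x
    ring
  · intro t x
    have : lam * (1 / lam) = 1 := by field_simp
    linear_combination (g' (t + c * x) + 1 / lam * charInt c (fun t x => χ' t * σ₂ x + a * φ₁' t x) t x) * hlc +
      (S₂ t x + a * φ₁ t x) * this
  · intro t
    rw [← hφ₁eq]
    simp [charInt]
  · intro t
    simp [hφ₂, charInt]
  · intro A hA
    have hq0 : ∀ t x, A t x → q t x = 0 := by
      intro t x ht
      obtain ⟨hx, -, -, h2, h3⟩ := hA t x ht
      have : charInt c S₂ t x = 0 := charInt_eq_zero hx fun ξ hξ => by
        simp [hS₂, (hA _ _ (h3 ξ hξ).2).2.1]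
      simp [hq, h2, this]
    have h1 : ∀ t x, A t x → φ₁ t x = 0 := by
      refine hvan A fun t x ht => ?_
      obtain ⟨hx, -, h1, -, h3⟩ := hA t x ht
      refine ⟨hx, ?_, h3⟩
      have e1 : charInt 1 S₁ t x = 0 := charInt_eq_zero hx fun ξ hξ => by
        simp only [hS₁, (hA _ _ (h3 ξ hξ).1).2.1, zero_mul]
      have e2 : charInt 1 q t x = 0 := charInt_eq_zero hx fun ξ hξ => hq0 _ _ (h3 ξ hξ).1
      rw [one_mul, h1, e1, e2]
      ring
    intro t x ht
    refine ⟨h1 t x ht, ?_⟩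
    obtain ⟨hx, -, -, -, h3⟩ := hA t x ht
    rw [hφ₂q, hq0 t x ht, charInt_eq_zero hx fun ξ hξ => h1 _ _ (h3 ξ hξ).2]
    simp

/-- Solution of the adjoint system with sources `χ σ₁`, `χ σ₂` that satisfies the boundary
conditions adjoint to the observer and vanishes for times outside a bounded interval. -/
theorem IsBacksteppingKernel.exists_dual_solution {lam a b L : ℝ} {P₁ P₂ : ℝ → ℝ → ℝ}
    (hP : IsBacksteppingKernel lam a b L P₁ P₂) (hlam : 0 < lam) (hL : 0 < L)
    {T₀ T₁ : ℝ} {χ σ₁ σ₂ : ℝ → ℝ} (hχ : ContDiff ℝ 1 χ) (hs : ∀ t, χ t ≠ 0 → T₀ < t ∧ t < T₁)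
    (hσ₁ : Continuous σ₁) (hσ₂ : Continuous σ₂) :
    ∃ φ₁ φ₁t φ₁x φ₂ φ₂t φ₂x : ℝ → ℝ → ℝ,
      HasPartials φ₁ φ₁t φ₁x ∧ HasPartials φ₂ φ₂t φ₂x ∧
      (∀ t x, φ₁t t x - φ₁x t x = b * φ₂ t x + χ t * σ₁ x) ∧
      (∀ t x, φ₂t t x + lam * φ₂x t x = a * φ₁ t x + χ t * σ₂ x) ∧
      (∀ t, φ₁ t 0 = lam * φ₂ t 0) ∧
      (∀ t, lam * (φ₂ t L + ∫ ξ in (0 : ℝ)..L, (P₁ ξ L * φ₁ t ξ + P₂ ξ L * φ₂ t ξ)) = 0) ∧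
      (∀ t x, 0 ≤ x → t + x ≤ T₀ - L / lam → φ₁ t x = 0 ∧ φ₂ t x = 0) ∧
      (∀ t x, 0 ≤ x → T₁ + x / lam ≤ t → φ₁ t x = 0 ∧ φ₂ t x = 0) := by
  have cP₁ := hP.contDiff_fst.continuous
  have cP₂ := hP.contDiff_snd.continuous
  have dχ : ∀ t, HasDerivAt χ (deriv χ t) t := fun t =>
    (hχ.differentiable one_ne_zero t).hasDerivAt
  have cχ := hχ.continuous
  have cχ' : Continuous (deriv χ) := hχ.continuous_deriv le_rfl
  have hcs : HasCompactSupport χ := HasCompactSupport.of_support_subset_isCompact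
    (isCompact_Icc (a := T₀) (b := T₁)) fun t ht => ⟨(hs t ht).1.le, (hs t ht).2.le⟩
  have bχ : ∃ C, ∀ t, |χ t| ≤ C := cχ.bounded_above_of_compact_support hcs
  have bχ' : ∃ C, ∀ t, |deriv χ t| ≤ C := cχ'.bounded_above_of_compact_support hcs.deriv
  have hχ0 : ∀ t, t ≤ T₀ → χ t = 0 := fun t ht => by
    by_contra h; exact absurd (hs t h).1 (not_lt.2 ht)
  have hχ1 : ∀ t, T₁ ≤ t → χ t = 0 := fun t ht => by
    by_contra h; exact absurd (hs t h).2 (not_lt.2 ht)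
  set ρ : ℝ → ℝ := fun x => σ₂ x + ∫ ξ in (0 : ℝ)..x, (P₁ ξ x * σ₁ ξ + P₂ ξ x * σ₂ ξ) with hρ
  have cρ : Continuous ρ := by
    have : Continuous fun x => ∫ ξ in (0 : ℝ)..x, (P₁ ξ x * σ₁ ξ + P₂ ξ x * σ₂ ξ) :=
      intervalIntegral.continuous_parametric_intervalIntegral_of_continuous
        (f := fun x ξ => P₁ ξ x * σ₁ ξ + P₂ ξ x * σ₂ ξ) (by fun_prop) continuous_id
    fun_prop
  set c := -1 / lam with hc
  have pρ := (hasFstPartial_mul dχ cχ' cρ).charInt c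
  set F := charInt c fun t x => χ t * ρ x with hF
  set F' := charInt c fun t x => deriv χ t * ρ x with hF'
  -- `g` is the only datum for which the transform vanishes at `x = L`: along the characteristic
  -- from `(t, 0)` to `(t + L / lam, L)` it must cancel the accumulated sources `χ ρ`.
  set g : ℝ → ℝ := fun t => -(1 / lam) * F (t + L / lam) L with hg
  have dg : ∀ t, HasDerivAt g (-(1 / lam) * F' (t + L / lam) L) t := fun t =>
    ((pρ.fst (t + L / lam) L).comp_add_const t (L / lam)).const_mul _
  have cg' : Continuous fun t => -(1 / lam) * F' (t + L / lam) L := by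
    have := pρ.cont_fst
    fun_prop
  have bdd : ∀ G : ℝ → ℝ → ℝ, BddOnStrips G → ∃ C, ∀ t, |-(1 / lam) * G (t + L / lam) L| ≤ C := by
    intro G hG
    obtain ⟨C, hC⟩ := hG.const_mul (-(1 / lam)) |L|
    exact ⟨C, fun t => hC _ _ le_rfl⟩
  obtain ⟨φ₁, φ₁t, φ₁x, φ₂, φ₂t, φ₂x, h₁, h₂, e₁, e₂, e₃, e₄, hvan⟩ :=
    exists_adjoint_cauchy hlam a b dg cg' (bdd F ((BddOnStrips.of_mul bχ cρ).charInt c))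
      (bdd F' ((BddOnStrips.of_mul bχ' cρ).charInt c)) dχ cχ' bχ bχ' hσ₁ hσ₂
  have hLl : 0 < L / lam := by positivity
  have hg0 : ∀ s, s ≤ T₀ - L / lam → g s = 0 := by
    intro s hs
    have : F (s + L / lam) L = 0 := charInt_eq_zero hL.le fun ξ hξ => by
      have : (-1 / lam) * (L - ξ) ≤ 0 :=
        mul_nonpos_of_nonpos_of_nonneg (by rw [neg_div]; simp [hlam.le]) (by linarith [hξ.2])
      simp only [hχ0 _ (by rw [hc]; linarith : s + L / lam + c * (L - ξ) ≤ T₀), zero_mul]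
    simp only [hg, this, mul_zero]
  have hg1 : ∀ s, T₁ ≤ s → g s = 0 := by
    intro s hs
    have : F (s + L / lam) L = 0 := charInt_eq_zero hL.le fun ξ hξ => by
      have h1 : s + L / lam + c * (L - ξ) = s + ξ / lam := by rw [hc]; field_simp; ring
      have h2 : 0 ≤ ξ / lam := div_nonneg hξ.1 hlam.le
      simp only [h1, hχ1 _ (by linarith : T₁ ≤ s + ξ / lam), zero_mul]
    simp only [hg, this, mul_zero]
  have e₀ : ∀ t, φ₁ t 0 = lam * φ₂ t 0 := fun t => by rw [e₃, e₄]
  refine ⟨φ₁, φ₁t, φ₁x, φ₂, φ₂t, φ₂x, h₁, h₂, e₁, e₂, e₀, fun t => ?_, fun t x hx ht => ?_,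
    fun t x hx ht => ?_⟩
  · have := hP.transform_eq hlam hL h₁ h₂ (S₁ := fun t x => χ t * σ₁ x)
      (S₂ := fun t x => χ t * σ₂ x) (by fun_prop) (by fun_prop) e₁ e₂ e₀ (t - L / lam)
    rw [sub_add_cancel, e₄] at this
    rw [this]
    have hFe : F t L = ∫ x in (0 : ℝ)..L, (χ (t - L / lam + x / lam) * σ₂ x +
        ∫ ξ in (0 : ℝ)..x, (P₁ ξ x * (χ (t - L / lam + x / lam) * σ₁ ξ) +
          P₂ ξ x * (χ (t - L / lam + x / lam) * σ₂ ξ))) := by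
      refine intervalIntegral.integral_congr fun x _ => ?_
      have h1 : t + c * (L - x) = t - L / lam + x / lam := by rw [hc]; field_simp; ring
      simp only [hρ, h1]
      rw [mul_add, ← intervalIntegral.integral_const_mul]
      congr 2
      ext ξ
      ring
    rw [← hFe]
    simp only [hg, sub_add_cancel]
    field_simp
    ring
  -- Followed back to `x = 0`, one family of characteristics keeps `t + x` constant and the other
  -- decreases it.
  · refine hvan (fun t x => 0 ≤ x ∧ t + x ≤ T₀ - L / lam) ?_ t x ⟨hx, ht⟩
    rintro t x ⟨hx, ht⟩
    have hxl : 0 ≤ x / lam := div_nonneg hx hlam.le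
    refine ⟨hx, hχ0 t (by linarith), hg0 _ ht, hg0 _ ?_, fun ξ hξ => ⟨⟨hξ.1, by linarith⟩, hξ.1, ?_⟩⟩
    · rw [neg_div, neg_mul, one_div_mul_eq_div]; linarith
    · have : 0 ≤ (x - ξ) / lam := div_nonneg (by linarith [hξ.2]) hlam.le
      rw [neg_div, neg_mul, one_div_mul_eq_div]; linarith [hξ.2]
  · refine hvan (fun t x => 0 ≤ x ∧ T₁ + x / lam ≤ t) ?_ t x ⟨hx, ht⟩
    rintro t x ⟨hx, ht⟩
    have hxl : 0 ≤ x / lam := div_nonneg hx hlam.le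
    refine ⟨hx, hχ1 t (by linarith), hg1 _ (by linarith), hg1 _ ?_,
      fun ξ hξ => ⟨⟨hξ.1, ?_⟩, hξ.1, ?_⟩⟩
    · rw [neg_div, neg_mul, one_div_mul_eq_div]; linarith
    · have : ξ / lam ≤ x / lam := by gcongr; exact hξ.2
      linarith [hξ.2]
    · rw [neg_div, neg_mul, one_div_mul_eq_div, sub_div]; linarith

/-! ### Pairings and the weak identity for the error -/

section Error

open Filter Topology

variable {L : ℝ}

/-- The `L²(0, L)` pairing of a state with a function. -/
noncomputable def pairing (f : StateSpace L) (ψ : ℝ → ℝ) : ℝ := ∫ x in Ioo 0 L, f x * ψ x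

theorem memLp_restrict_Ioo_of_continuous {ψ : ℝ → ℝ} (hψ : Continuous ψ) :
    MemLp ψ 2 ((volume : Measure ℝ).restrict (Ioo 0 L)) := by
  obtain ⟨C, hC⟩ := (isCompact_Icc (a := 0) (b := L)).exists_bound_of_continuousOn hψ.continuousOn
  refine MemLp.of_bound hψ.aestronglyMeasurable C ?_
  exact (ae_restrict_iff' measurableSet_Ioo).2
    (Eventually.of_forall fun x hx => hC x (Ioo_subset_Icc_self hx))

theorem integrable_pairing (f : StateSpace L) {ψ : ℝ → ℝ} (hψ : Continuous ψ) :
    Integrable (fun x => f x * ψ x) ((volume : Measure ℝ).restrict (Ioo 0 L)) :=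
  (Lp.memLp f).integrable_mul (memLp_restrict_Ioo_of_continuous hψ)

theorem pairing_sub_left (f g : StateSpace L) {ψ : ℝ → ℝ} (hψ : Continuous ψ) :
    pairing (f - g) ψ = pairing f ψ - pairing g ψ := by
  unfold pairing
  rw [← integral_sub (integrable_pairing f hψ) (integrable_pairing g hψ)]
  refine integral_congr_ae ?_
  filter_upwards [Lp.coeFn_sub f g] with x hx
  rw [hx, Pi.sub_apply, sub_mul]

theorem pairing_add_right (f : StateSpace L) {ψ η : ℝ → ℝ} (hψ : Continuous ψ) (hη : Continuous η) :
    pairing f (fun x => ψ x + η x) = pairing f ψ + pairing f η := by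
  unfold pairing
  rw [← integral_add (integrable_pairing f hψ) (integrable_pairing f hη)]
  simp only [mul_add]

theorem pairing_const_mul_right (f : StateSpace L) (k : ℝ) (ψ : ℝ → ℝ) :
    pairing f (fun x => k * ψ x) = k * pairing f ψ := by
  unfold pairing
  rw [← integral_const_mul]
  congr 1; ext x; ring

theorem pairing_zero_left (ψ : ℝ → ℝ) : pairing (0 : StateSpace L) ψ = 0 := by
  unfold pairing
  refine integral_eq_zero_of_ae ?_
  filter_upwards [Lp.coeFn_zero ℝ 2 ((volume : Measure ℝ).restrict (Ioo 0 L))] with x hx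
  rw [hx, Pi.zero_apply, zero_mul]

theorem pairing_eq_zero (f : StateSpace L) {ψ : ℝ → ℝ} (h : ∀ x ∈ Ioo 0 L, ψ x = 0) :
    pairing f ψ = 0 :=
  setIntegral_eq_zero_of_forall_eq_zero fun x hx => by rw [h x hx, mul_zero]

theorem continuous_section {ψ : ℝ → ℝ → ℝ} (hψ : Continuous (Function.uncurry ψ)) (t : ℝ) :
    Continuous (ψ t) :=
  hψ.comp (Continuous.prodMk_right t)

/-- Compactness of `[0, L]` makes nearby sections uniformly close, and on a finite measure space
this controls the `L²` norm. -/
theorem continuous_toLp_of_continuous {ψ : ℝ → ℝ → ℝ} (hψ : Continuous (Function.uncurry ψ)) :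
    Continuous fun t => (memLp_restrict_Ioo_of_continuous (L := L)
      (continuous_section hψ t)).toLp (ψ t) := by
  rw [continuous_iff_continuousAt]
  intro t
  rw [Metric.continuousAt_iff']
  intro ε hε
  set K : ℝ := measureUnivNNReal ((volume : Measure ℝ).restrict (Ioo 0 L)) ^ ((2 : ENNReal).toReal)⁻¹
  have hK : 0 ≤ K := by positivity
  set δ := ε / (K + 1) / 2
  have hδ : 0 < δ := by positivity
  have hev : ∀ᶠ s in 𝓝 t, ∀ x ∈ Icc 0 L, |ψ s x - ψ t x| ≤ δ := by
    refine isCompact_Icc.eventually_forall_of_forall_eventually fun x _ => ?_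
    have hc : Continuous fun z : ℝ × ℝ => |ψ z.1 z.2 - ψ t z.2| := by fun_prop
    have := hc.tendsto (t, x)
    simp only [sub_self, abs_zero] at this
    exact this.eventually (eventually_le_nhds hδ)
  filter_upwards [hev] with s hs
  rw [dist_eq_norm, ← MemLp.toLp_sub]
  refine lt_of_le_of_lt (Lp.norm_le_of_ae_bound (C := δ) hδ.le ?_) ?_
  · filter_upwards [MemLp.coeFn_toLp ((memLp_restrict_Ioo_of_continuous (L := L)
      (continuous_section hψ s)).sub (memLp_restrict_Ioo_of_continuous (L := L)
      (continuous_section hψ t))), ae_restrict_mem measurableSet_Ioo] with x hx hxm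
    rw [hx]
    exact hs x (Ioo_subset_Icc_self hxm)
  · calc K * δ ≤ (K + 1) * δ := by gcongr; linarith
      _ = ε / 2 := by simp only [δ]; field_simp
      _ < ε := by linarith

theorem continuousOn_pairing {y : ℝ → StateSpace L} {ψ : ℝ → ℝ → ℝ} {s : Set ℝ}
    (hy : ContinuousOn y s) (hψ : Continuous (Function.uncurry ψ)) :
    ContinuousOn (fun t => pairing (y t) (ψ t)) s := by
  have := hy.inner (𝕜 := ℝ) (continuous_toLp_of_continuous (L := L) hψ).continuousOn
  refine this.congr fun t _ => ?_
  dsimp only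
  rw [L2.inner_def]
  refine integral_congr_ae ?_
  filter_upwards [MemLp.coeFn_toLp (memLp_restrict_Ioo_of_continuous (L := L)
      (continuous_section hψ t))] with x hx
  rw [hx]
  simp [mul_comm]

theorem continuous_setIntegral_mul {Γ : ℝ → ℝ} (hΓ : Continuous Γ) {ψ : ℝ → ℝ → ℝ}
    (hψ : Continuous (Function.uncurry ψ)) (hL : 0 < L) :
    Continuous fun t => ∫ x in Ioo 0 L, Γ x * ψ t x := by
  have : Continuous fun t => ∫ x in (0 : ℝ)..L, Γ x * ψ t x :=
    intervalIntegral.continuous_parametric_intervalIntegral_of_continuous'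
      (f := fun t x => Γ x * ψ t x) (by fun_prop) _ _
  simpa only [intervalIntegral.integral_of_le hL.le, integral_Ioc_eq_integral_Ioo] using this

theorem IsL2Loc.intervalIntegrable {g : ℝ → ℝ} (hg : IsL2Loc g) {τ : ℝ} (hτ : 0 ≤ τ) :
    IntervalIntegrable g volume 0 τ := by
  rcases hτ.eq_or_lt with rfl | h
  · exact IntervalIntegrable.refl
  · rw [intervalIntegrable_iff_integrableOn_Ioo_of_le hτ]
    exact (hg τ h).integrable one_le_two

/-- Weak identity for the difference of two solutions of a transport equation. -/
theorem IsTransportSolution.sub_identity {c k : ℝ} {p q y z : ℝ → StateSpace L}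
    {Γ Y Z yl yr zl zr : ℝ → ℝ}
    (hy : IsTransportSolution L c (fun t x => -k * p t x) y yl yr)
    (hz : IsTransportSolution L c (fun t x => -k * q t x + Γ x * (Y t - Z t)) z zl zr)
    (hp : ContinuousOn p (Ici 0)) (hq : ContinuousOn q (Ici 0)) (hY : IsL2Loc Y) (hZ : IsL2Loc Z)
    (hΓ : Continuous Γ) (hL : 0 < L) {φ φt φx : ℝ → ℝ → ℝ} (hφ : HasPartials φ φt φx)
    {τ : ℝ} (hτ : 0 ≤ τ) :
    IntervalIntegrable (fun t => pairing (y t - z t) (fun x => φt t x + c * φx t x)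
        - k * pairing (p t - q t) (φ t) - (Y t - Z t) * (∫ x in Ioo 0 L, Γ x * φ t x)
        - c * ((yr t - zr t) * φ t L - (yl t - zl t) * φ t 0)) volume 0 τ ∧
    pairing (y τ - z τ) (φ τ) - pairing (y 0 - z 0) (φ 0) =
      ∫ t in (0 : ℝ)..τ, (pairing (y t - z t) (fun x => φt t x + c * φx t x)
        - k * pairing (p t - q t) (φ t) - (Y t - Z t) * (∫ x in Ioo 0 L, Γ x * φ t x)
        - c * ((yr t - zr t) * φ t L - (yl t - zl t) * φ t 0)) := by
  have cφ := hφ.cont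
  have cφt := hφ.cont_fst
  have cφx := hφ.cont_snd
  have cφs : ∀ t, Continuous (φ t) := fun t => by fun_prop
  have hsub : uIcc 0 τ ⊆ Ici 0 := by rw [uIcc_of_le hτ]; exact Icc_subset_Ici_self
  have ii : ∀ {y : ℝ → StateSpace L} {ψ : ℝ → ℝ → ℝ}, ContinuousOn y (Ici 0) →
      Continuous (Function.uncurry ψ) →
      IntervalIntegrable (fun t => pairing (y t) (ψ t)) volume 0 τ := fun hy hψ =>
    ((continuousOn_pairing hy hψ).mono hsub).intervalIntegrable
  have cD : Continuous (Function.uncurry fun t x => φt t x + c * φx t x) := by fun_prop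
  have cG := continuous_setIntegral_mul hΓ cφ hL
  have iG : IntervalIntegrable (fun t => (Y t - Z t) * ∫ x in Ioo 0 L, Γ x * φ t x) volume 0 τ :=
    ((hY.intervalIntegrable hτ).sub (hZ.intervalIntegrable hτ)).mul_continuousOn cG.continuousOn
  have ib : ∀ {g : ℝ → ℝ}, IsL2Loc g → ∀ x, IntervalIntegrable (fun t => g t * φ t x) volume 0 τ :=
    fun hg x => (hg.intervalIntegrable hτ).mul_continuousOn (by fun_prop)
  have iyl := ib hy.left_l2Loc 0
  have iyr := ib hy.right_l2Loc L
  have izl := ib hz.left_l2Loc 0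
  have izr := ib hz.right_l2Loc L
  have iy := ii hy.continuousOn cD
  have iz := ii hz.continuousOn cD
  have ip := ii hp cφ
  have iq := ii hq cφ
  have wy := hy.weak φ hφ.contDiff τ hτ
  have wz := hz.weak φ hφ.contDiff τ hτ
  simp only [(hφ.fst _ _).deriv, (hφ.snd _ _).deriv] at wy wz
  have fy : ∀ t, ∫ x in Ioo 0 L, -k * p t x * φ t x = -k * pairing (p t) (φ t) := fun t => by
    unfold pairing
    rw [← integral_const_mul]; congr 1; ext x; ring
  have iΓ : ∀ t, Integrable (fun x => Γ x * φ t x) ((volume : Measure ℝ).restrict (Ioo 0 L)) :=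
    fun t => (by fun_prop : Continuous fun x => Γ x * φ t x).integrableOn_Icc.mono_set Ioo_subset_Icc_self
  have fz : ∀ t, ∫ x in Ioo 0 L, (-k * q t x + Γ x * (Y t - Z t)) * φ t x =
      -k * pairing (q t) (φ t) + (Y t - Z t) * ∫ x in Ioo 0 L, Γ x * φ t x := fun t => by
    unfold pairing
    rw [← integral_const_mul, ← integral_const_mul,
      ← integral_add ((integrable_pairing (q t) (cφs t)).const_mul _) ((iΓ t).const_mul _)]
    congr 1; ext x; ring
  simp only [fy, fz] at wy wz
  change pairing (y τ) (φ τ) - pairing (y 0) (φ 0) = (∫ t in (0 : ℝ)..τ,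
    pairing (y t) (fun x => φt t x + c * φx t x)) + _ - _ at wy
  change pairing (z τ) (φ τ) - pairing (z 0) (φ 0) = (∫ t in (0 : ℝ)..τ,
    pairing (z t) (fun x => φt t x + c * φx t x)) + _ - _ at wz
  have e : (fun t => pairing (y t - z t) (fun x => φt t x + c * φx t x)
        - k * pairing (p t - q t) (φ t) - (Y t - Z t) * (∫ x in Ioo 0 L, Γ x * φ t x)
        - c * ((yr t - zr t) * φ t L - (yl t - zl t) * φ t 0)) = fun t =>
      (pairing (y t) (fun x => φt t x + c * φx t x) + -k * pairing (p t) (φ t)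
        - c * (yr t * φ t L - yl t * φ t 0)) -
      (pairing (z t) (fun x => φt t x + c * φx t x) + (-k * pairing (q t) (φ t) +
        (Y t - Z t) * (∫ x in Ioo 0 L, Γ x * φ t x)) - c * (zr t * φ t L - zl t * φ t 0)) := by
    ext t
    rw [pairing_sub_left _ _ (by fun_prop), pairing_sub_left _ _ (cφs t)]
    ring
  have jy := (iy.add (ip.const_mul (-k))).sub ((iyr.sub iyl).const_mul c)
  have jz := (iz.add ((iq.const_mul (-k)).add iG)).sub ((izr.sub izl).const_mul c)
  refine ⟨by rw [e]; exact jy.sub jz, ?_⟩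
  rw [e, intervalIntegral.integral_sub jy jz,
    intervalIntegral.integral_sub (iy.add (ip.const_mul (-k))) ((iyr.sub iyl).const_mul c),
    intervalIntegral.integral_add iy (ip.const_mul (-k)),
    intervalIntegral.integral_sub (iz.add ((iq.const_mul (-k)).add iG)) ((izr.sub izl).const_mul c),
    intervalIntegral.integral_add iz ((iq.const_mul (-k)).add iG),
    intervalIntegral.integral_const_mul c, intervalIntegral.integral_const_mul c,
    ← wy, ← wz, pairing_sub_left _ _ (cφs τ), pairing_sub_left _ _ (cφs 0)]
  ring

/-- The final time `τ` may depend on `χ`: once it lies beyond the support, the integral up to `τ` is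
the full integral, so the fundamental lemma of the calculus of variations applies. -/
theorem ae_eq_zero_of_forall_test {T : ℝ} (hT : 0 ≤ T) {f : ℝ → ℝ}
    (hf : ∀ τ, 0 ≤ τ → IntervalIntegrable f volume 0 τ)
    (h : ∀ (χ : ℝ → ℝ) (T₁ : ℝ), ContDiff ℝ 1 χ → T < T₁ → (∀ t, χ t ≠ 0 → T < t ∧ t < T₁) →
      ∃ τ, T₁ ≤ τ ∧ ∫ t in (0 : ℝ)..τ, χ t * f t = 0) :
    ∀ᵐ t ∂(volume.restrict (Ioi T)), f t = 0 := by
  have hloc : LocallyIntegrableOn f (Ioi T) volume := by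
    rw [locallyIntegrableOn_iff isOpen_Ioi.isLocallyClosed]
    intro K hK hKc
    obtain ⟨M, hM⟩ := hKc.bddAbove
    have := (intervalIntegrable_iff_integrableOn_Ioc_of_le (le_max_left 0 M)).1
      (hf _ (le_max_left 0 M))
    exact this.mono_set fun x hx => ⟨hT.trans_lt (hK hx), (hM hx).trans (le_max_right _ _)⟩
  rw [ae_restrict_iff' measurableSet_Ioi]
  refine isOpen_Ioi.ae_eq_zero_of_integral_contDiff_smul_eq_zero hloc fun χ hχ hc hsub => ?_
  obtain ⟨M, hM⟩ := hc.isCompact.bddAbove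
  have hs : ∀ t, χ t ≠ 0 → T < t ∧ t < max (M + 1) (T + 1) := fun t ht =>
    ⟨hsub (subset_tsupport _ ht),
      lt_of_lt_of_le (by linarith [hM (subset_tsupport _ ht)] : t < M + 1) (le_max_left _ _)⟩
  obtain ⟨τ, hτ, h0⟩ := h χ (max (M + 1) (T + 1)) (hχ.of_le (by exact_mod_cast le_top))
    (lt_of_lt_of_le (lt_add_one T) (le_max_right _ _)) hs
  rw [← h0]
  refine (intervalIntegral.integral_eq_integral_of_support_subset fun t ht => ?_).symm
  have : χ t ≠ 0 := fun h => ht (by simp [h])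
  exact ⟨hT.trans_lt (hs t this).1, (hs t this).2.le.trans hτ⟩

theorem stateSpace_eq_zero {f : StateSpace L} (h : ∀ σ : ℝ → ℝ, Continuous σ → pairing f σ = 0) :
    f = 0 := by
  rw [Lp.eq_zero_iff_ae_eq_zero]
  have hf : IntegrableOn f (Ioo 0 L) volume := (Lp.memLp f).integrable one_le_two
  have := isOpen_Ioo.ae_eq_zero_of_integral_contDiff_smul_eq_zero hf.locallyIntegrableOn
    fun g hg hc hsub => by
      refine Eq.trans ?_ (h g hg.continuous)
      rw [pairing, ← setIntegral_eq_integral_of_forall_compl_eq_zero (s := Ioo 0 L)]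
      · simp only [smul_eq_mul, mul_comm]
      · intro x hx
        rw [image_eq_zero_of_notMem_tsupport fun h => hx (hsub h), zero_smul]
  exact (ae_restrict_iff' measurableSet_Ioo).2 this

/-! ### Vanishing of the error and of its boundary values -/

variable {lam a b : ℝ} {Γ₁ Γ₂ U w Y v Z : ℝ → ℝ} {y₁ y₂ z₁ z₂ : ℝ → StateSpace L}

theorem pairing_error_eq_zero {P₁ P₂ : ℝ → ℝ → ℝ} (hP : IsBacksteppingKernel lam a b L P₁ P₂)
    (hlam : 0 < lam) (hL : 0 < L) (hy : IsPlantSolution lam a b L U y₁ y₂ w Y)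
    (hz : IsObserverSolution lam a b L (fun x => lam * P₁ x L) (fun x => lam * P₂ x L) U Y
      z₁ z₂ v Z)
    {σ₁ σ₂ : ℝ → ℝ} (hσ₁ : Continuous σ₁) (hσ₂ : Continuous σ₂) {t : ℝ}
    (ht : (lam + 1) / lam * L ≤ t) :
    pairing (y₁ t - z₁ t) σ₁ + pairing (y₂ t - z₂ t) σ₂ = 0 := by
  set T := (lam + 1) / lam * L with hT
  have hT0 : 0 < T := by positivity
  have cP₁ := hP.contDiff_fst.continuous
  have cP₂ := hP.contDiff_snd.continuous
  have cΓ₁ : Continuous fun x => lam * P₁ x L := by fun_prop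
  have cΓ₂ : Continuous fun x => lam * P₂ x L := by fun_prop
  have ce₁ : ContinuousOn (fun t => y₁ t - z₁ t) (Ici 0) :=
    hy.fst.continuousOn.sub hz.fst.continuousOn
  have ce₂ : ContinuousOn (fun t => y₂ t - z₂ t) (Ici 0) :=
    hy.snd.continuousOn.sub hz.snd.continuousOn
  set N : ℝ → ℝ := fun t => pairing (y₁ t - z₁ t) σ₁ + pairing (y₂ t - z₂ t) σ₂ with hN
  have cN : ContinuousOn N (Ici 0) :=
    (continuousOn_pairing ce₁ (ψ := fun _ => σ₁) (by fun_prop)).add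
      (continuousOn_pairing ce₂ (ψ := fun _ => σ₂) (by fun_prop))
  have hae : ∀ᵐ t ∂(volume.restrict (Ioi T)), N t = 0 := by
    refine ae_eq_zero_of_forall_test hT0.le (fun τ hτ => (cN.mono ?_).intervalIntegrable) ?_
    · rw [uIcc_of_le hτ]; exact Icc_subset_Ici_self
    intro χ T₁ hχ hTT₁ hs
    obtain ⟨φ₁, φ₁t, φ₁x, φ₂, φ₂t, φ₂x, h₁, h₂, e₁, e₂, e₀, eL, hlow, hup⟩ :=
      hP.exists_dual_solution hlam hL hχ hs hσ₁ hσ₂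
    have hLl : 0 < L / lam := by positivity
    have cφ₁ := h₁.cont
    have cφ₂ := h₂.cont
    have hτ : 0 ≤ T₁ + L / lam := by linarith
    -- By this time the last influence of the sources, travelling at speed `lam`, has left `[0, L]`.
    refine ⟨T₁ + L / lam, by linarith, ?_⟩
    obtain ⟨i₁, w₁⟩ := hy.fst.sub_identity hz.fst hy.snd.continuousOn hz.snd.continuousOn
      hy.snd.right_l2Loc hz.snd.right_l2Loc cΓ₁ hL h₁ hτ
    obtain ⟨i₂, w₂⟩ := hy.snd.sub_identity hz.snd hy.fst.continuousOn hz.fst.continuousOn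
      hy.snd.right_l2Loc hz.snd.right_l2Loc cΓ₂ hL h₂ hτ
    -- The minimal time enters here: with `χ` starting at `T`, the dual solution vanishes for `t + x
    -- ≤ L`, hence on `(0, L)` at time `0`.
    have hTL : T - L / lam = L := by rw [hT]; field_simp; ring
    have low : ∀ x ∈ Ioo 0 L, φ₁ 0 x = 0 ∧ φ₂ 0 x = 0 := fun x hx =>
      hlow 0 x hx.1.le (by linarith [hx.2])
    have up : ∀ x ∈ Ioo 0 L, φ₁ (T₁ + L / lam) x = 0 ∧ φ₂ (T₁ + L / lam) x = 0 := fun x hx => by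
      refine hup _ x hx.1.le ?_
      have : x / lam ≤ L / lam := by gcongr; exact hx.2.le
      linarith
    rw [pairing_eq_zero _ fun x hx => (low x hx).1, pairing_eq_zero _ fun x hx => (up x hx).1] at w₁
    rw [pairing_eq_zero _ fun x hx => (low x hx).2, pairing_eq_zero _ fun x hx => (up x hx).2] at w₂
    have hsum := intervalIntegral.integral_add i₁ i₂
    rw [← w₁, ← w₂] at hsum
    refine Eq.trans (intervalIntegral.integral_congr fun t _ => ?_) (hsum.trans (by ring))
    have c₁ := continuous_section cφ₁ t
    have c₂ := continuous_section cφ₂ t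
    have p₁ : pairing (y₁ t - z₁ t) (fun x => φ₁t t x + -1 * φ₁x t x) =
        b * pairing (y₁ t - z₁ t) (φ₂ t) + χ t * pairing (y₁ t - z₁ t) σ₁ := by
      rw [← pairing_const_mul_right, ← pairing_const_mul_right,
        ← pairing_add_right _ (by fun_prop) (by fun_prop)]
      congr 1; ext x; linear_combination e₁ t x
    have p₂ : pairing (y₂ t - z₂ t) (fun x => φ₂t t x + lam * φ₂x t x) =
        a * pairing (y₂ t - z₂ t) (φ₁ t) + χ t * pairing (y₂ t - z₂ t) σ₂ := by
      rw [← pairing_const_mul_right, ← pairing_const_mul_right,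
        ← pairing_add_right _ (by fun_prop) (by fun_prop)]
      congr 1; ext x; exact e₂ t x
    have hL' := eL t
    rw [intervalIntegral.integral_add
        ((by fun_prop : Continuous fun ξ => P₁ ξ L * φ₁ t ξ).intervalIntegrable _ _)
        ((by fun_prop : Continuous fun ξ => P₂ ξ L * φ₂ t ξ).intervalIntegrable _ _),
      intervalIntegral.integral_of_le hL.le, intervalIntegral.integral_of_le hL.le,
      integral_Ioc_eq_integral_Ioo, integral_Ioc_eq_integral_Ioo] at hL'
    have g₁ : ∫ x in Ioo 0 L, lam * P₁ x L * φ₁ t x = lam * ∫ x in Ioo 0 L, P₁ x L * φ₁ t x := by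
      rw [← integral_const_mul]; simp only [mul_assoc]
    have g₂ : ∫ x in Ioo 0 L, lam * P₂ x L * φ₂ t x = lam * ∫ x in Ioo 0 L, P₂ x L * φ₂ t x := by
      rw [← integral_const_mul]; simp only [mul_assoc]
    simp only [hN]
    rw [p₁, p₂, g₁, g₂]
    -- The output error is multiplied by the nonlocal condition, the boundary error at `0` by the
    -- condition `e₀`. The terms at `x = L` in the first equation cancel because `U` is shared.
    linear_combination (Y t - Z t) * hL' + (w t - v t) * e₀ t
  -- Continuity of `N` upgrades the almost everywhere statement and includes the endpoint `T`.
  have heq : EqOn N (fun _ => 0) (Ici T) := by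
    have hsub : Ici T ⊆ Ici 0 := Ici_subset_Ici.2 hT0.le
    refine Measure.eqOn_of_ae_eq (μ := volume) ?_ (cN.mono hsub) continuousOn_const ?_
    · rw [← restrict_Ioi_eq_restrict_Ici]
      exact hae
    · rw [interior_Ici, closure_Ioi]
  exact heq ht

theorem hasPartials_mul {χ χ' ψ ψ' : ℝ → ℝ} (hχ : ∀ t, HasDerivAt χ (χ' t) t)
    (hψ : ∀ x, HasDerivAt ψ (ψ' x) x) (cχ' : Continuous χ') (cψ' : Continuous ψ') :
    HasPartials (fun t x => χ t * ψ x) (fun t x => χ' t * ψ x) (fun t x => χ t * ψ' x) := by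
  have cχ : Continuous χ := continuous_iff_continuousAt.2 fun t => (hχ t).continuousAt
  have cψ : Continuous ψ := continuous_iff_continuousAt.2 fun t => (hψ t).continuousAt
  exact ⟨fun t x => (hχ t).mul_const _, fun t x => (hψ x).const_mul _, by fun_prop, by fun_prop⟩

/-- Where two solutions of a transport equation agree, so do their boundary values, up to the
difference of the injections. -/
theorem IsTransportSolution.boundary_identity {c k : ℝ} {p q y z : ℝ → StateSpace L}
    {Γ Y Z yl yr zl zr : ℝ → ℝ}
    (hy : IsTransportSolution L c (fun t x => -k * p t x) y yl yr)
    (hz : IsTransportSolution L c (fun t x => -k * q t x + Γ x * (Y t - Z t)) z zl zr)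
    (hp : ContinuousOn p (Ici 0)) (hq : ContinuousOn q (Ici 0)) (hY : IsL2Loc Y) (hZ : IsL2Loc Z)
    (hΓ : Continuous Γ) (hL : 0 < L) {T : ℝ} (hT : 0 ≤ T) (hyz : ∀ t, T ≤ t → y t = z t)
    (hpq : ∀ t, T ≤ t → p t = q t) {ψ : ℝ → ℝ} (hψ : ContDiff ℝ 1 ψ) :
    ∀ᵐ t ∂(volume.restrict (Ioi T)), (Y t - Z t) * (∫ x in Ioo 0 L, Γ x * ψ x) +
        c * ((yr t - zr t) * ψ L - (yl t - zl t) * ψ 0) = 0 := by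
  refine ae_eq_zero_of_forall_test hT (fun τ hτ => ?_) fun χ T₁ hχ hTT₁ hs => ⟨T₁, le_rfl, ?_⟩
  · have iyl := hy.left_l2Loc.intervalIntegrable hτ
    have iyr := hy.right_l2Loc.intervalIntegrable hτ
    have izl := hz.left_l2Loc.intervalIntegrable hτ
    have izr := hz.right_l2Loc.intervalIntegrable hτ
    exact (((hY.intervalIntegrable hτ).sub (hZ.intervalIntegrable hτ)).mul_const _).add
      ((((iyr.sub izr).mul_const _).sub ((iyl.sub izl).mul_const _)).const_mul c)
  have dχ : ∀ t, HasDerivAt χ (deriv χ t) t := fun t =>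
    (hχ.differentiable one_ne_zero t).hasDerivAt
  have hp := hasPartials_mul dχ (fun x => (hψ.differentiable one_ne_zero x).hasDerivAt)
    (hχ.continuous_deriv le_rfl) (hψ.continuous_deriv le_rfl)
  obtain ⟨-, h⟩ := hy.sub_identity hz ‹_› hq hY hZ hΓ hL hp (hT.trans hTT₁.le)
  have hχ0 : ∀ t, t ≤ T → χ t = 0 := fun t ht => by
    by_contra h; exact absurd (hs t h).1 (not_lt.2 ht)
  have hχ1 : χ T₁ = 0 := by
    by_contra h; exact lt_irrefl _ (hs _ h).2
  have hd0 : ∀ t, t < T → deriv χ t = 0 := fun t ht => by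
    have : χ =ᶠ[𝓝 t] fun _ => 0 := by
      filter_upwards [Iio_mem_nhds ht] with s hs using hχ0 s (le_of_lt hs)
    rw [this.deriv_eq, deriv_const]
  rw [pairing_eq_zero _ fun x _ => by rw [hχ1, zero_mul],
    pairing_eq_zero _ fun x _ => by rw [hχ0 0 hT, zero_mul]] at h
  rw [← neg_eq_zero, ← intervalIntegral.integral_neg]
  refine Eq.trans (intervalIntegral.integral_congr fun t _ => ?_) (h.symm.trans (sub_self 0))
  have hG : ∫ x in Ioo 0 L, Γ x * (χ t * ψ x) = χ t * ∫ x in Ioo 0 L, Γ x * ψ x := by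
    rw [← integral_const_mul]; congr 1; ext x; ring
  have e₁ : pairing (y t - z t) (fun x => deriv χ t * ψ x + c * (χ t * deriv ψ x)) = 0 := by
    rcases lt_or_ge t T with ht | ht
    · exact pairing_eq_zero _ fun x _ => by rw [hd0 t ht, hχ0 t ht.le]; ring
    · rw [hyz t ht, sub_self, pairing_zero_left]
  have e₂ : pairing (p t - q t) (fun x => χ t * ψ x) = 0 := by
    rcases lt_or_ge t T with ht | ht
    · exact pairing_eq_zero _ fun x _ => by rw [hχ0 t ht.le, zero_mul]
    · rw [hpq t ht, sub_self, pairing_zero_left]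
  rw [hG, e₁, e₂]
  ring

/-- High powers concentrate at `x = L`: the integral is at most `C L ^ (n + 2) / (n + 2)` in
absolute value, so the boundary term dominates once `n` is large. -/
theorem exists_pow_functional_pos {Γ : ℝ → ℝ} (hΓ : Continuous Γ) (hlam : 0 < lam) (hL : 0 < L) :
    ∃ n : ℕ, 0 < (∫ x in Ioo 0 L, Γ x * x ^ (n + 1)) + lam * L ^ (n + 1) := by
  obtain ⟨C, hC⟩ := (isCompact_Icc (a := 0) (b := L)).exists_bound_of_continuousOn hΓ.continuousOn
  obtain ⟨n, hn⟩ := exists_nat_gt (C * L / lam)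
  refine ⟨n, ?_⟩
  have h1 : ‖∫ x in (0 : ℝ)..L, Γ x * x ^ (n + 1)‖ ≤ ∫ x in (0 : ℝ)..L, C * x ^ (n + 1) := by
    refine intervalIntegral.norm_integral_le_of_norm_le hL.le (Eventually.of_forall fun x hx => ?_)
      ((by fun_prop : Continuous fun x : ℝ => C * x ^ (n + 1)).intervalIntegrable _ _)
    rw [norm_mul, Real.norm_of_nonneg (pow_nonneg hx.1.le _)]
    have := hx.1.le
    gcongr
    exact hC x (Ioc_subset_Icc_self hx)
  rw [intervalIntegral.integral_const_mul, integral_pow, intervalIntegral.integral_of_le hL.le,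
    integral_Ioc_eq_integral_Ioo, Real.norm_eq_abs] at h1
  have h2 : C * ((L ^ (n + 1 + 1) - 0 ^ (n + 1 + 1)) / ((n + 1 : ℕ) + 1)) < lam * L ^ (n + 1) := by
    have h3 : C * L < lam * (n + 2) := by
      rw [div_lt_iff₀ hlam] at hn; nlinarith
    have h4 : C * ((L ^ (n + 1 + 1) - 0 ^ (n + 1 + 1)) / ((n + 1 : ℕ) + 1)) =
        C * L / (n + 2) * L ^ (n + 1) := by
      push_cast
      rw [zero_pow (by omega), show (n : ℝ) + 1 + 1 = n + 2 by ring]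
      ring
    rw [h4]
    gcongr
    rw [div_lt_iff₀ (by positivity)]
    exact h3
  linarith [neg_abs_le (∫ x in Ioo 0 L, Γ x * x ^ (n + 1))]

end Error

theorem proposition5p1 (lam a b L : ℝ) (hlam : 0 < lam) (hL : 0 < L) :
    ∃ P₁ P₂ : ℝ → ℝ → ℝ, IsBacksteppingKernel lam a b L P₁ P₂ ∧
      ∃ Γ₁ Γ₂ : ℝ → ℝ,
        (∀ x ∈ Set.Icc 0 L, Γ₁ x = lam * P₁ x L) ∧
        (∀ x ∈ Set.Icc 0 L, Γ₂ x = lam * P₂ x L) ∧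
        ∀ (U : ℝ → ℝ) (y₁ y₂ z₁ z₂ : ℝ → StateSpace L) (w Y v Z : ℝ → ℝ),
          IsPlantSolution lam a b L U y₁ y₂ w Y →
          IsObserverSolution lam a b L Γ₁ Γ₂ U Y z₁ z₂ v Z →
          (∀ t : ℝ, (lam + 1) / lam * L ≤ t → y₁ t = z₁ t ∧ y₂ t = z₂ t) ∧
          (∀ᵐ t ∂(MeasureTheory.volume.restrict (Set.Ici ((lam + 1) / lam * L))),
            w t = v t ∧ Y t = Z t) := by
  obtain ⟨P₁, P₂, hP⟩ := exists_isBacksteppingKernel hlam a b L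
  refine ⟨P₁, P₂, hP, fun x => lam * P₁ x L, fun x => lam * P₂ x L, fun _ _ => rfl,
    fun _ _ => rfl, fun U y₁ y₂ z₁ z₂ w Y v Z hy hz => ?_⟩
  have hstate : ∀ t : ℝ, (lam + 1) / lam * L ≤ t → y₁ t = z₁ t ∧ y₂ t = z₂ t := by
    intro t ht
    constructor
    · refine sub_eq_zero.1 (stateSpace_eq_zero fun σ hσ => ?_)
      have := pairing_error_eq_zero hP hlam hL hy hz hσ (continuous_const (y := (0 : ℝ))) ht
      rwa [pairing_eq_zero (y₂ t - z₂ t) fun x _ => rfl, add_zero] at this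
    · refine sub_eq_zero.1 (stateSpace_eq_zero fun σ hσ => ?_)
      have := pairing_error_eq_zero hP hlam hL hy hz (continuous_const (y := (0 : ℝ))) hσ ht
      rwa [pairing_eq_zero (y₁ t - z₁ t) fun x _ => rfl, zero_add] at this
  refine ⟨hstate, ?_⟩
  have cP₁ := hP.contDiff_fst.continuous
  have cP₂ := hP.contDiff_snd.continuous
  have cΓ₁ : Continuous fun x => lam * P₁ x L := by fun_prop
  have cΓ₂ : Continuous fun x => lam * P₂ x L := by fun_prop
  have hT : 0 ≤ (lam + 1) / lam * L := by positivity
  obtain ⟨n, hn⟩ := exists_pow_functional_pos cΓ₂ hlam hL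
  -- A positive power vanishes at `x = 0`, which decouples the output error from the boundary error
  -- there; its remaining coefficient is the positive number in `hn`.
  have hpow := hy.snd.boundary_identity hz.snd hy.fst.continuousOn hz.fst.continuousOn
    hy.snd.right_l2Loc hz.snd.right_l2Loc cΓ₂ hL hT (fun t ht => (hstate t ht).2)
    (fun t ht => (hstate t ht).1) (contDiff_id.pow (n + 1))
  -- With the output errors equal to zero and `U` shared, the constant test function leaves only `w
  -- - v`.
  have hone := hy.fst.boundary_identity hz.fst hy.snd.continuousOn hz.snd.continuousOn
    hy.snd.right_l2Loc hz.snd.right_l2Loc cΓ₁ hL hT (fun t ht => (hstate t ht).1)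
    (fun t ht => (hstate t ht).2) (contDiff_const (c := (1 : ℝ)))
  rw [← restrict_Ioi_eq_restrict_Ici]
  filter_upwards [hpow, hone] with t h1 h2
  have hE : Y t - Z t = 0 := by
    simp only [id, zero_pow (Nat.succ_ne_zero n), mul_zero, sub_zero] at h1
    have : (Y t - Z t) * ((∫ x in Ioo 0 L, lam * P₂ x L * x ^ (n + 1)) + lam * L ^ (n + 1)) = 0 := by
      linear_combination h1
    exact (mul_eq_zero.1 this).resolve_right hn.ne'
  rw [hE] at h2
  constructor <;> linarith
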